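/- Let $k$ be an algebraically closed field of characteristic $0$ and let $H=T_2(-1)$ be Sweedler's Hopf algebra: it is generated by $g,x$ with $g^2=1$, $x^2=0$, $gx=-xg$, with $\Delta(g)=g\otimes g$, $\Delta(x)=x\otimes 1+g\otimes x$, $\epsilon(g)=1$, $\epsilon(x)=0$, $S(g)=g$, $S(x)=-gx$. Let $\widehat D(H)=\mathrm{End}_k(H)$ with the product $$(f\star f')(h)=f(h^1)^2\,f'\big(S(f(h^1)^3)\,h^2\,f(h^1)^1\big),$$ with unit $\epsilon(-)1$, and let $\sigma=\mathrm{id}_H$, a central element. Write $g\in\widehat D(H)$ for the map $h\mapsto\epsilon(h)g$ and $g'\in\widehat D(H)$ for the map $h\mapsto\chi(h)1$, where $\chi:H\to k$ is the character with $\chi(g)=-1$, $\chi(x)=0$. Put $D_0=\widehat D(H)/(gg'-1)$. For a $k$-algebra $R$ and a central element $z\in R$, let $R[\theta]=R\oplus R\theta$ be the DG algebra with $R$ in degree $0$, $\theta$ in degree $-1$, $r\theta=\theta r$ for $r\in R$, $\theta^2=0$, $d|_R=0$ and $d\theta=z$. Let $\mathcal C_0$ be the DG category of DG modules over $D_0[\theta]$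 with $d\theta=\sigma-1$ (the $s=0$ block of the mixed anti-Yetter–Drinfeld contramodules over $H$), and let $\mathcal M$ be the DG category of mixed complexes, i.e. of DG modules over $k[\theta]$ with $d\theta=0$. Then $\mathcal C_0$ is DG-equivalent to $\mathcal M$: there is a $k$-linear DG functor $F:\mathcal C_0\to\mathcal M$ that is a quasi-equivalence (it induces isomorphisms on the cohomology of all morphism complexes and an essentially surjective functor $H^0(\mathcal C_0)\to H^0(\mathcal M)$). Moreover $F$ can be chosen so that a closed morphism $f$ of degree $0$ is a quasi-isomorphism if and only if $F(f)$ is, and so that $F$ takes h-projective DG modules to h-projective DG modules and restricts to a quasi-equivalence between the full DG subcategories of h-projective DG modules (the derived DG categories). (A DG module $M$ is h-projective if the morphism complex from $M$ to every acyclic DG module is acyclic.) Furthermore, the category of $D_0/(\sigma-1)$-modules is equivalent, by a $k$-linear functor, to the category of $k$-vector spaces, and multiplication by $\sigma-1$ on $D_0$ is diagonalizable. -/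

import Mathlib

universe u v w u1 v1 u2 v2

noncomputable section

open scoped TensorProduct Quaternion

namespace TwistedDouble

open Coalgebra HopfAlgebra

section Aux

variable {k : Type u} [Field k] {H : Type v} [Ring H]

theorem conv_apply [Bialgebra k H] {E : Type*} [Semiring E] [Algebra k E]
    (P Q : WithConv (H →ₗ[k] E)) (x : H) :
    (P * Q) x = ∑ i ∈ (ℛ k x).index, P ((ℛ k x).left i) * Q ((ℛ k x).right i) :=
  (ℛ k x).convMul_apply P Q

/-- Intertwiners pass to convolution products. -/
theorem conv_intertwine [Bialgebra k H] {V W : Type*} [AddCommGroup V] [Module k V]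
    [AddCommGroup W] [Module k W] (r : W →ₗ[k] V)
    (P P2 : WithConv (H →ₗ[k] Module.End k V)) (Q Q2 : WithConv (H →ₗ[k] Module.End k W))
    (h1 : ∀ x w, P x (r w) = r (Q x w)) (h2 : ∀ x w, P2 x (r w) = r (Q2 x w)) (x : H) (w : W) :
    (P * P2) x (r w) = r ((Q * Q2) x w) := by
  rw [conv_apply, conv_apply]
  simp only [LinearMap.sum_apply, Module.End.mul_apply, h2, h1, map_sum]

/-- A convolution product of two commuting multiplicative maps is multiplicative. -/
theorem conv_mul_of_commute [Bialgebra k H] {E : Type*} [Semiring E] [Algebra k E]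
    (P Q : WithConv (H →ₗ[k] E)) (hP : ∀ x y, P (x * y) = P x * P y)
    (hQ : ∀ x y, Q (x * y) = Q x * Q y) (hc : ∀ x y, Commute (P x) (Q y)) (x y : H) :
    (P * Q) (x * y) = (P * Q) x * (P * Q) y := by
  rw [((ℛ k x).mul (ℛ k y)).convMul_apply, conv_apply, conv_apply, Finset.sum_mul_sum]
  simp only [Coalgebra.Repr.mul_index, Finset.sum_product]
  refine Finset.sum_congr rfl fun i _ => Finset.sum_congr rfl fun j _ => ?_
  simp only [Coalgebra.Repr.mul_left, Coalgebra.Repr.mul_right, hP, hQ, mul_assoc]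
  rw [← mul_assoc (P ((ℛ k y).left j)), (hc _ _).eq, mul_assoc]

theorem conv_commute [Bialgebra k H] {E : Type*} [Semiring E] [Algebra k E]
    (P Q : WithConv (H →ₗ[k] E)) (e : E) (hP : ∀ x, Commute e (P x))
    (hQ : ∀ x, Commute e (Q x)) (x : H) : Commute e ((P * Q) x) := by
  rw [conv_apply]
  exact Commute.sum_right _ _ _ fun i _ => (hP _).mul_right (hQ _)

open Algebra.TensorProduct in
/-- The antipode is an anti-homomorphism of coalgebras. -/
theorem comul_antipode [HopfAlgebra k H] (x : H) :
    comul (R := k) (antipode k x) =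
      ∑ i ∈ (ℛ k x).index, antipode k ((ℛ k x).right i) ⊗ₜ[k] antipode k ((ℛ k x).left i) := by
  let iL : H →ₐ[k] H ⊗[k] H := includeLeft
  let iR : H →ₐ[k] H ⊗[k] H := includeRight
  let U : WithConv (H →ₗ[k] H ⊗[k] H) := .toConv (iR.toLinearMap ∘ₗ antipode k)
  let V : WithConv (H →ₗ[k] H ⊗[k] H) := .toConv (iL.toLinearMap ∘ₗ antipode k)
  let X : WithConv (H →ₗ[k] H ⊗[k] H) := .toConv (iL.toLinearMap ∘ₗ LinearMap.id)
  let Y : WithConv (H →ₗ[k] H ⊗[k] H) := .toConv (iR.toLinearMap ∘ₗ LinearMap.id)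
  have hone (i : H →ₐ[k] H ⊗[k] H) :
      i.toLinearMap ∘ₗ (1 : WithConv (H →ₗ[k] H)).ofConv =
        (1 : WithConv (H →ₗ[k] H ⊗[k] H)).ofConv := by
    ext y
    simp
  have hVX : V * X = 1 := by
    have := LinearMap.algHom_comp_convMul_distrib iL (WithConv.toConv (antipode k (A := H)))
      (WithConv.toConv LinearMap.id)
    rw [LinearMap.antipode_mul_id, hone] at this
    exact WithConv.ofConv_injective this.symm
  have hUY : U * Y = 1 := by
    have := LinearMap.algHom_comp_convMul_distrib iR (WithConv.toConv (antipode k (A := H)))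
      (WithConv.toConv LinearMap.id)
    rw [LinearMap.antipode_mul_id, hone] at this
    exact WithConv.ofConv_injective this.symm
  have hXY : X * Y = WithConv.toConv (comul (R := k)) := by
    ext y
    rw [conv_apply]
    simp [X, Y, iL, iR, (ℛ k y).eq]
  have hl : (U * V) * WithConv.toConv (comul (R := k)) = 1 := by
    rw [← hXY, mul_assoc, ← mul_assoc V, hVX, one_mul, hUY]
  have := left_inv_eq_right_inv hl (LinearMap.comul_right_inv (R := k) (C := H))
  have h2 := congrArg (fun t : WithConv (H →ₗ[k] H ⊗[k] H) => t x) this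
  change (U * V) x = comul (R := k) (antipode k x) at h2
  rw [← h2, conv_apply]
  simp [U, V, iL, iR]

end Aux

end TwistedDouble

open Coalgebra HopfAlgebra

/-- The twisted double of a Hopf algebra `H`: the space `End(H)` of linear endomorphisms, with the
product of `TwistedDouble.star` (not with composition). -/
def TwistedDouble (k : Type u) [Field k] (H : Type v) [Ring H] [HopfAlgebra k H] : Type v :=
  H →ₗ[k] H

namespace TwistedDouble

variable (k : Type u) [Field k] (H : Type v) [Ring H] [HopfAlgebra k H]

instance : AddCommGroup (TwistedDouble k H) := inferInstanceAs (AddCommGroup (H →ₗ[k] H))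

instance : Module k (TwistedDouble k H) := inferInstanceAs (Module k (H →ₗ[k] H))

/-- `opA a φ = φ(- a)` -/
def opA : H →ₗ[k] Module.End k (H →ₗ[k] H) :=
  (LinearMap.llcomp k H H H).flip ∘ₗ (LinearMap.mul k H).flip

/-- `opB b φ = b φ(-)` -/
def opB : H →ₗ[k] Module.End k (H →ₗ[k] H) :=
  (LinearMap.llcomp k H H H) ∘ₗ LinearMap.mul k H

/-- `opC c φ = φ(S(c) -)` -/
def opC : H →ₗ[k] Module.End k (H →ₗ[k] H) :=
  (LinearMap.llcomp k H H H).flip ∘ₗ LinearMap.mul k H ∘ₗ antipode k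

variable {k H}

@[simp] theorem opA_apply (a : H) (φ : H →ₗ[k] H) (h : H) : opA k H a φ h = φ (h * a) := rfl

@[simp] theorem opB_apply (b : H) (φ : H →ₗ[k] H) (h : H) : opB k H b φ h = b * φ h := rfl

@[simp] theorem opC_apply (c : H) (φ : H →ₗ[k] H) (h : H) :
    opC k H c φ h = φ (antipode k c * h) := rfl

variable (k H) in
/-- The action of `H` on `End(H)` given by `x • φ = x² φ(S(x³)(-)x¹)`, where `x¹ ⊗ x² ⊗ x³` is the
iterated coproduct: this is the convolution product of the three operators above. -/
def act : H →ₗ[k] Module.End k (H →ₗ[k] H) :=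
  (WithConv.toConv (opA k H) * (WithConv.toConv (opB k H) * WithConv.toConv (opC k H))).ofConv

theorem act_apply (x : H) (φ : H →ₗ[k] H) (h : H) :
    act k H x φ h = ∑ i ∈ (ℛ k x).index, ∑ j ∈ (ℛ k ((ℛ k x).right i)).index,
      (ℛ k ((ℛ k x).right i)).left j *
        φ (antipode k ((ℛ k ((ℛ k x).right i)).right j) * h * (ℛ k x).left i) := by
  change (WithConv.toConv (opA k H) *
    (WithConv.toConv (opB k H) * WithConv.toConv (opC k H))) x φ h = _
  simp only [conv_apply, LinearMap.sum_apply, Module.End.mul_apply, map_sum, mul_assoc]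
  rfl

/-- The product `(f ⋆ g)(h) = f(h¹)² g(S(f(h¹)³) h² f(h¹)¹)`, that is
`(f ⋆ g)(h) = (f(h¹) • g)(h²)` for the action `act`. -/
def star (f g : H →ₗ[k] H) : H →ₗ[k] H :=
  TensorProduct.lift ((act k H).flip g ∘ₗ f) ∘ₗ comul

theorem star_apply (f g : H →ₗ[k] H) (h : H) :
    star f g h = ∑ i ∈ (ℛ k h).index, act k H (f ((ℛ k h).left i)) g ((ℛ k h).right i) := by
  rw [star, LinearMap.comp_apply, ← (ℛ k h).eq]
  simp

theorem act_mul (x y : H) : act k H (x * y) = act k H x * act k H y := by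
  refine conv_mul_of_commute (WithConv.toConv (opA k H))
    (WithConv.toConv (opB k H) * WithConv.toConv (opC k H)) ?_ ?_ ?_ x y
  · intro x y; ext φ h; simp [mul_assoc]
  · refine conv_mul_of_commute _ _ ?_ ?_ ?_
    · intro x y; ext φ h; simp [mul_assoc]
    · intro x y; ext φ h; simp [mul_assoc, antipode_mul_antidistrib]
    · intro x y; ext φ h; simp
  · intro x y
    refine conv_commute _ _ _ ?_ ?_ _
    · intro y; ext φ h; simp
    · intro y; ext φ h; simp [mul_assoc]

theorem act_one : act k H (1 : H) = 1 := by
  change (WithConv.toConv (opA k H) *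
    (WithConv.toConv (opB k H) * WithConv.toConv (opC k H))) 1 = _
  rw [LinearMap.convMul_apply, Bialgebra.comul_one, Algebra.TensorProduct.one_def]
  simp only [TensorProduct.map_tmul]
  ext φ h
  have : ((WithConv.toConv (opB k H) * WithConv.toConv (opC k H)) 1) = 1 := by
    rw [LinearMap.convMul_apply, Bialgebra.comul_one, Algebra.TensorProduct.one_def]
    ext φ h
    simp
  change (opA k H 1 * ((WithConv.toConv (opB k H) * WithConv.toConv (opC k H)) 1)) φ h = _
  rw [this]
  simp

section assoc

/-- Functions of two variables, as linear maps on `H ⊗ H`. -/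
abbrev W2 (k : Type u) [Field k] (H : Type v) [Ring H] [HopfAlgebra k H] : Type v :=
  (H ⊗[k] H) →ₗ[k] H

variable (k H) in
/-- Right translation of the argument. -/
def opA2 : H ⊗[k] H →ₗ[k] Module.End k (W2 k H) :=
  (LinearMap.llcomp k (H ⊗[k] H) (H ⊗[k] H) H).flip ∘ₗ (LinearMap.mul k (H ⊗[k] H)).flip

variable (k H) in
/-- Left multiplication of the values. -/
def opB2 : H →ₗ[k] Module.End k (W2 k H) :=
  (LinearMap.llcomp k (H ⊗[k] H) H H) ∘ₗ LinearMap.mul k H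

variable (k H) in
/-- Left translation of the argument. -/
def opC2 : H ⊗[k] H →ₗ[k] Module.End k (W2 k H) :=
  (LinearMap.llcomp k (H ⊗[k] H) (H ⊗[k] H) H).flip ∘ₗ LinearMap.mul k (H ⊗[k] H)

@[simp] theorem opA2_apply (t : H ⊗[k] H) (ω : W2 k H) (s : H ⊗[k] H) :
    opA2 k H t ω s = ω (s * t) := rfl

@[simp] theorem opB2_apply (b : H) (ω : W2 k H) (s : H ⊗[k] H) : opB2 k H b ω s = b * ω s := rfl

@[simp] theorem opC2_apply (t : H ⊗[k] H) (ω : W2 k H) (s : H ⊗[k] H) :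
    opC2 k H t ω s = ω (t * s) := rfl

variable (k H) in
/-- Restriction along the coproduct. -/
def rho : W2 k H →ₗ[k] (H →ₗ[k] H) := (LinearMap.llcomp k H (H ⊗[k] H) H).flip comul

@[simp] theorem rho_apply (ω : W2 k H) (h : H) : rho k H ω h = ω (comul h) := rfl

/-- `h ⊗ l ↦ (g(h) • e)(l)` -/
def omega (e : H →ₗ[k] H) : (H →ₗ[k] H) →ₗ[k] W2 k H :=
  (TensorProduct.lift.equiv (.id k) H H H).toLinearMap ∘ₗ
    LinearMap.llcomp k H H (H →ₗ[k] H) ((act k H).flip e)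

@[simp] theorem omega_apply (e g : H →ₗ[k] H) (h l : H) :
    omega e g (h ⊗ₜ l) = act k H (g h) e l := by
  simp [omega]

theorem star_eq (e g : H →ₗ[k] H) : star g e = rho k H (omega e g) := by
  ext h
  rw [star_apply, rho_apply, ← (ℛ k h).eq]
  simp

/-- The product `End(H) × End(H) → End(H)` is `H`-linear in the first variable. -/
theorem act_star (x : H) (g e : H →ₗ[k] H) : act k H x (star g e) = star (act k H x g) e := by
  let i1 : H →ₗ[k] H ⊗[k] H := (Algebra.TensorProduct.includeLeft : H →ₐ[k] _).toLinearMap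
  let i2 : H →ₗ[k] H ⊗[k] H := (Algebra.TensorProduct.includeRight : H →ₐ[k] _).toLinearMap
  let A : WithConv (H →ₗ[k] Module.End k (H →ₗ[k] H)) := .toConv (opA k H)
  let B : WithConv (H →ₗ[k] Module.End k (H →ₗ[k] H)) := .toConv (opB k H)
  let C : WithConv (H →ₗ[k] Module.End k (H →ₗ[k] H)) := .toConv (opC k H)
  let P1 : WithConv (H →ₗ[k] Module.End k (W2 k H)) := .toConv (opA2 k H ∘ₗ i1)
  let P2 : WithConv (H →ₗ[k] Module.End k (W2 k H)) := .toConv (opA2 k H ∘ₗ i2)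
  let P3 : WithConv (H →ₗ[k] Module.End k (W2 k H)) := .toConv (opB2 k H)
  let P4 : WithConv (H →ₗ[k] Module.End k (W2 k H)) := .toConv (opC2 k H ∘ₗ i2 ∘ₗ antipode k)
  let P5 : WithConv (H →ₗ[k] Module.End k (W2 k H)) := .toConv (opC2 k H ∘ₗ i1 ∘ₗ antipode k)
  have hA : P1 * P2 = WithConv.toConv (opA2 k H ∘ₗ comul) := by
    ext x ω : 3
    rw [conv_apply]
    change _ = (opA2 k H (comul x)) ω
    rw [← (ℛ k x).eq]
    simp only [map_sum, LinearMap.sum_apply]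
    refine Finset.sum_congr rfl fun i _ => ?_
    refine LinearMap.ext fun s => ?_
    simp [P1, P2, i1, i2, mul_assoc]
  have hC : P4 * P5 = WithConv.toConv (opC2 k H ∘ₗ comul ∘ₗ antipode k) := by
    ext x ω : 3
    rw [conv_apply]
    change _ = (opC2 k H (comul (antipode k x))) ω
    rw [comul_antipode]
    simp only [map_sum, LinearMap.sum_apply]
    refine Finset.sum_congr rfl fun i _ => ?_
    refine LinearMap.ext fun s => ?_
    simp [P4, P5, i1, i2, ← mul_assoc]
  have key1 : ∀ (x : H) (ω : W2 k H), (A * (B * C)) x (rho k H ω) =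
      rho k H (((P1 * P2) * (P3 * (P4 * P5))) x ω) := by
    refine conv_intertwine _ _ _ _ _ ?_ (conv_intertwine _ _ _ _ _ ?_ ?_)
    · intro x ω; rw [hA]; ext h; simp [A]
    · intro x ω; ext h; simp [B, P3]
    · intro x ω; rw [hC]; ext h; simp [C]
  have key2 : ∀ (x : H) (g : H →ₗ[k] H), (P1 * ((P2 * (P3 * P4)) * P5)) x (omega e g) =
      omega e ((A * (B * C)) x g) := by
    refine conv_intertwine _ _ _ _ _ ?_ (conv_intertwine _ _ _ _ _ ?_ ?_)
    · intro x g; ext h l; simp [A, P1, i1]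
    · intro x g; ext h l
      simp only [conv_apply, LinearMap.sum_apply, Module.End.mul_apply, map_sum]
      simp only [TensorProduct.AlgebraTensorModule.curry_apply, LinearMap.restrictScalars_self,
        TensorProduct.curry_apply, LinearMap.coe_sum, Finset.sum_apply, omega_apply, B,
        opB_apply, act_mul, Module.End.mul_apply]
      rw [act_apply]
      refine Finset.sum_congr rfl fun i _ => Finset.sum_congr rfl fun j _ => ?_
      simp [P2, P3, P4, i2, mul_assoc]
    · intro x g; ext h l; simp [C, P5, i1]
  change (A * (B * C)) x (star g e) = star ((A * (B * C)) x g) e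
  rw [star_eq, star_eq, key1, ← key2]
  simp only [mul_assoc]

theorem star_assoc (f g e : H →ₗ[k] H) : star (star f g) e = star f (star g e) := by
  let T : H →ₗ[k] H →ₗ[k] H →ₗ[k] H :=
    LinearMap.llcomp k H H (H →ₗ[k] H) ((act k H).flip e) ∘ₗ ((act k H).flip g ∘ₗ f)
  have hT (a b c : H) : T a b c = act k H (act k H (f a) g b) e c := rfl
  let T3 : H ⊗[k] (H ⊗[k] H) →ₗ[k] H :=
    TensorProduct.lift ((TensorProduct.lift.equiv (.id k) H H H).toLinearMap ∘ₗ T)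
  have hT3 (a b c : H) : T3 (a ⊗ₜ (b ⊗ₜ c)) = T a b c := by simp [T3]
  ext h
  have hc := congrArg T3 (Coalgebra.coassoc_apply (R := k) h)
  rw [← (ℛ k h).eq] at hc
  simp only [map_sum, LinearMap.rTensor_tmul, LinearMap.lTensor_tmul] at hc
  rw [star_apply, star_apply]
  refine Eq.trans (Eq.trans ?_ hc) ?_
  · refine Finset.sum_congr rfl fun i _ => ?_
    rw [star_apply, ← (ℛ k ((ℛ k h).left i)).eq]
    simp [hT3, hT, TensorProduct.sum_tmul]
  · refine Finset.sum_congr rfl fun i _ => ?_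
    rw [act_star, star_apply, ← (ℛ k ((ℛ k h).right i)).eq]
    simp [hT3, hT, TensorProduct.tmul_sum]

end assoc

/-- The unit `ε(-) 1`. -/
def unit : H →ₗ[k] H := Algebra.linearMap k H ∘ₗ counit

theorem unit_apply (h : H) : (unit : H →ₗ[k] H) h = algebraMap k H (counit h) := rfl

theorem unit_star (g : H →ₗ[k] H) : star unit g = g := by
  ext h
  rw [star_apply]
  simp only [unit_apply, Algebra.algebraMap_eq_smul_one, map_smul, act_one, LinearMap.smul_apply,
    Module.End.one_apply]
  simp only [← map_smul, ← map_sum]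
  rw [sum_counit_smul]

theorem sum_counit_smul_left (x : H) :
    ∑ i ∈ (ℛ k x).index, (counit ((ℛ k x).right i) : k) • (ℛ k x).left i = x := by
  have := congrArg (TensorProduct.rid k H) (sum_tmul_counit_eq (R := k) (ℛ k x))
  simpa only [map_sum, TensorProduct.rid_tmul, one_smul] using this

theorem act_unit (x h : H) : act k H x unit h = (counit h : k) • x := by
  rw [act_apply]
  have h1 (i : H × H) : ∑ j ∈ (ℛ k ((ℛ k x).right i)).index,
      (ℛ k ((ℛ k x).right i)).left j * (unit : H →ₗ[k] H)
        (antipode k ((ℛ k ((ℛ k x).right i)).right j) * h * (ℛ k x).left i) =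
      (counit h : k) • (counit ((ℛ k x).left i) : k) • (ℛ k x).right i := by
    conv_rhs => rw [← sum_counit_smul_left (k := k) ((ℛ k x).right i)]
    simp only [Finset.smul_sum]
    refine Finset.sum_congr rfl fun j _ => ?_
    simp only [unit_apply, Bialgebra.counit_mul, counit_antipode, Algebra.algebraMap_eq_smul_one,
      mul_smul_comm, mul_one, smul_smul]
    congr 1
    ring
  simp only [h1, ← Finset.smul_sum, sum_counit_smul]

theorem star_unit (f : H →ₗ[k] H) : star f unit = f := by
  ext h
  rw [star_apply]
  simp only [act_unit, ← map_smul, ← map_sum, sum_counit_smul_left]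

theorem act_id (x : H) : act k H x LinearMap.id = LinearMap.mulRight k x := by
  have hBC (y h : H) : (WithConv.toConv (opB k H) * WithConv.toConv (opC k H)) y LinearMap.id h =
      (counit y : k) • h := by
    rw [conv_apply]
    simp only [LinearMap.sum_apply, Module.End.mul_apply, opB_apply, opC_apply,
      LinearMap.id_apply, ← mul_assoc]
    rw [← Finset.sum_mul, sum_mul_antipode_eq_smul, smul_mul_assoc, one_mul]
  ext h
  change (WithConv.toConv (opA k H) *
    (WithConv.toConv (opB k H) * WithConv.toConv (opC k H))) x LinearMap.id h = _
  rw [conv_apply]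
  simp only [LinearMap.sum_apply, Module.End.mul_apply, opA_apply, hBC, LinearMap.mulRight_apply]
  simp only [← mul_smul_comm, ← Finset.mul_sum]
  rw [sum_counit_smul_left]

theorem star_id (f : H →ₗ[k] H) (h : H) :
    star f LinearMap.id h = ∑ i ∈ (ℛ k h).index, (ℛ k h).right i * f ((ℛ k h).left i) := by
  rw [star_apply]
  simp [act_id]

theorem id_star (f : H →ₗ[k] H) (h : H) :
    star LinearMap.id f h = ∑ i ∈ (ℛ k h).index, (ℛ k h).right i * f ((ℛ k h).left i) := by
  let A : WithConv (H →ₗ[k] Module.End k (H →ₗ[k] H)) := .toConv (opA k H)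
  let B : WithConv (H →ₗ[k] Module.End k (H →ₗ[k] H)) := .toConv (opB k H)
  let C : WithConv (H →ₗ[k] Module.End k (H →ₗ[k] H)) := .toConv (opC k H)
  let T : H →ₗ[k] H →ₗ[k] H →ₗ[k] H :=
    (LinearMap.llcomp k H (H →ₗ[k] H) (H →ₗ[k] H)).flip ((opC k H).flip f) ∘ₗ (A * B).ofConv
  have hT (a b c : H) : T a b c = (A * B) a (opC k H b f) c := rfl
  let T3 : H ⊗[k] (H ⊗[k] H) →ₗ[k] H :=
    TensorProduct.lift ((TensorProduct.lift.equiv (.id k) H H H).toLinearMap ∘ₗ T)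
  have hT3 (a b c : H) : T3 (a ⊗ₜ (b ⊗ₜ c)) = T a b c := by simp [T3]
  have hc := congrArg T3 (Coalgebra.coassoc_apply (R := k) h)
  rw [← (ℛ k h).eq] at hc
  simp only [map_sum, LinearMap.rTensor_tmul, LinearMap.lTensor_tmul] at hc
  have hAB (a : H) (φ : H →ₗ[k] H) (l : H) : (A * B) a φ l =
      ∑ i ∈ (ℛ k a).index, (ℛ k a).right i * φ (l * (ℛ k a).left i) := by
    rw [conv_apply]
    simp [A, B]
  have hl : star LinearMap.id f h = ∑ i ∈ (ℛ k h).index,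
      T3 (TensorProduct.assoc k H H H (comul ((ℛ k h).left i) ⊗ₜ[k] (ℛ k h).right i)) := by
    rw [star_apply]
    refine Finset.sum_congr rfl fun i _ => ?_
    change (A * (B * C)) ((ℛ k h).left i) f _ = _
    rw [← mul_assoc, conv_apply, ← (ℛ k ((ℛ k h).left i)).eq]
    simp only [TensorProduct.sum_tmul, map_sum, TensorProduct.assoc_tmul, hT3, hT,
      LinearMap.sum_apply, Module.End.mul_apply]
    rfl
  have hin (a b : H) : T3 (a ⊗ₜ[k] comul b) = (counit b : k) • (A * B) a f 1 := by
    rw [← (ℛ k b).eq]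
    simp only [TensorProduct.tmul_sum, map_sum, hT3, hT, hAB, opC_apply, one_mul]
    rw [Finset.sum_comm, Finset.smul_sum]
    refine Finset.sum_congr rfl fun j _ => ?_
    rw [← Finset.mul_sum, ← map_sum]
    simp only [← mul_assoc, ← Finset.sum_mul]
    rw [sum_antipode_mul_eq_smul, smul_mul_assoc, one_mul, map_smul, mul_smul_comm]
  rw [hl, hc]
  simp only [hin]
  have hlin : ∑ i ∈ (ℛ k h).index, (counit ((ℛ k h).right i) : k) • (A * B) ((ℛ k h).left i) f 1 =
      (A * B) (∑ i ∈ (ℛ k h).index, (counit ((ℛ k h).right i) : k) • (ℛ k h).left i) f 1 := by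
    simp only [map_sum, map_smul, LinearMap.sum_apply, LinearMap.smul_apply]
  rw [hlin, sum_counit_smul_left, hAB]
  simp

theorem star_add (f g e : H →ₗ[k] H) : star f (g + e) = star f g + star f e := by
  ext h; simp [star_apply, Finset.sum_add_distrib]

theorem add_star (f g e : H →ₗ[k] H) : star (f + g) e = star f e + star g e := by
  ext h; simp [star_apply, Finset.sum_add_distrib]

theorem smul_star (c : k) (f g : H →ₗ[k] H) : star (c • f) g = c • star f g := by
  ext h; simp [star_apply, Finset.smul_sum]

theorem star_smul (c : k) (f g : H →ₗ[k] H) : star f (c • g) = c • star f g := by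
  ext h; simp [star_apply, Finset.smul_sum]

instance : Ring (TwistedDouble k H) where
  __ := (inferInstance : AddCommGroup (TwistedDouble k H))
  mul f g := star f g
  one := unit
  mul_assoc := star_assoc
  one_mul := unit_star
  mul_one := star_unit
  left_distrib := star_add
  right_distrib := add_star
  zero_mul g := by
    have := smul_star (0 : k) (0 : H →ₗ[k] H) g
    rwa [zero_smul, zero_smul] at this
  mul_zero f := by
    have := star_smul (0 : k) f (0 : H →ₗ[k] H)
    rwa [zero_smul, zero_smul] at this

instance : Algebra k (TwistedDouble k H) := Algebra.ofModule smul_star star_smul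

variable (k H) in
/-- The element of the twisted double given by a linear endomorphism of `H`. -/
def of (f : H →ₗ[k] H) : TwistedDouble k H := f

theorem of_mul_of (f g : H →ₗ[k] H) : of k H f * of k H g = of k H (star f g) := rfl

variable (k H) in
/-- The canonical element `σ` of the twisted double: `σ(h) = h`. -/
def sigma : TwistedDouble k H := of k H LinearMap.id

theorem sigma_comm (f : TwistedDouble k H) : sigma k H * f = f * sigma k H :=
  LinearMap.ext fun h => (id_star f h).trans (star_id f h).symm

end TwistedDouble

/-- Sweedler's algebra: the algebra with generators `g`, `x` and relations `g² = 1`, `x² = 0`,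
`gx = -xg`, with basis `1, g, x, gx`. Mathlib has this algebra as the (degenerate) quaternion
algebra with `i² = 1`, `j² = 0`, `ji = -ij`; its universal property is `QuaternionAlgebra.lift`. -/
abbrev Sweedler (k : Type u) [Field k] : Type u := ℍ[k,1,0,0]

namespace Sweedler

variable (k : Type u) [Field k]

/-- The generator `g`. -/
def g : Sweedler k := ⟨0, 1, 0, 0⟩

/-- The generator `x`. -/
def x : Sweedler k := ⟨0, 0, 1, 0⟩

theorem g_mul_g : g k * g k = 1 := by ext <;> simp [g]

theorem x_mul_x : x k * x k = 0 := by ext <;> simp [x]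

theorem g_mul_x : g k * x k = -(x k * g k) := by ext <;> simp [g, x]

theorem eq_lincomb (a : Sweedler k) :
    a = a.re • 1 + a.imI • g k + a.imJ • x k + a.imK • (g k * x k) := by
  ext <;> simp [g, x]

/-- The coproduct, `Δ(g) = g ⊗ g` and `Δ(x) = x ⊗ 1 + g ⊗ x`. -/
def comulHom : Sweedler k →ₐ[k] Sweedler k ⊗[k] Sweedler k :=
  QuaternionAlgebra.lift
    { i := g k ⊗ₜ g k
      j := x k ⊗ₜ 1 + g k ⊗ₜ x k
      k := (g k ⊗ₜ g k) * (x k ⊗ₜ 1 + g k ⊗ₜ x k)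
      i_mul_i := by simp [g_mul_g, Algebra.TensorProduct.one_def]
      j_mul_j := by
        simp [mul_add, add_mul, x_mul_x, g_mul_x, TensorProduct.neg_tmul]
      i_mul_j := rfl
      j_mul_i := by
        simp [mul_add, add_mul, g_mul_x, TensorProduct.neg_tmul, TensorProduct.tmul_neg,
          add_comm] }

/-- The counit, `ε(g) = 1` and `ε(x) = 0`. -/
def counitHom : Sweedler k →ₐ[k] k :=
  QuaternionAlgebra.lift
    { i := 1
      j := 0
      k := 0
      i_mul_i := by simp
      j_mul_j := by simp
      i_mul_j := by simp
      j_mul_i := by simp }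

/-- The antipode, `S(1) = 1`, `S(g) = g`, `S(x) = -gx`, `S(gx) = x`. -/
def antipodeMap : Sweedler k →ₗ[k] Sweedler k where
  toFun a := ⟨a.re, a.imI, a.imK, -a.imJ⟩
  map_add' a b := by ext <;> simp [add_comm]
  map_smul' c a := by ext <;> simp

@[simp] theorem comulHom_g : comulHom k (g k) = g k ⊗ₜ g k := by
  simp [comulHom, g, QuaternionAlgebra.Basis.liftHom, QuaternionAlgebra.Basis.lift]

@[simp] theorem comulHom_x : comulHom k (x k) = x k ⊗ₜ 1 + g k ⊗ₜ x k := by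
  simp [comulHom, x, QuaternionAlgebra.Basis.liftHom, QuaternionAlgebra.Basis.lift]

@[simp] theorem counitHom_g : counitHom k (g k) = 1 := by
  simp [counitHom, g, QuaternionAlgebra.Basis.liftHom, QuaternionAlgebra.Basis.lift]

@[simp] theorem counitHom_x : counitHom k (x k) = 0 := by
  simp [counitHom, x, QuaternionAlgebra.Basis.liftHom, QuaternionAlgebra.Basis.lift]

@[simp] theorem antipodeMap_one : antipodeMap k 1 = 1 := by ext <;> simp [antipodeMap]

@[simp] theorem antipodeMap_g : antipodeMap k (g k) = g k := by ext <;> simp [antipodeMap, g]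

@[simp] theorem antipodeMap_x : antipodeMap k (x k) = -(g k * x k) := by
  ext <;> simp [antipodeMap, g, x]

@[simp] theorem antipodeMap_gx : antipodeMap k (g k * x k) = x k := by
  ext <;> simp [antipodeMap, g, x]

theorem algHom_ext {A : Type*} [Ring A] [Algebra k A] {f f2 : Sweedler k →ₐ[k] A}
    (hg : f (g k) = f2 (g k)) (hx : f (x k) = f2 (x k)) : f = f2 :=
  QuaternionAlgebra.hom_ext hg hx

theorem linearMap_ext {M : Type*} [AddCommGroup M] [Module k M] {f f2 : Sweedler k →ₗ[k] M}
    (h1 : f 1 = f2 1) (hg : f (g k) = f2 (g k)) (hx : f (x k) = f2 (x k))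
    (hgx : f (g k * x k) = f2 (g k * x k)) : f = f2 := by
  refine LinearMap.ext fun a => ?_
  rw [eq_lincomb k a]
  simp only [map_add, map_smul, h1, hg, hx, hgx]

instance : Bialgebra k (Sweedler k) :=
  Bialgebra.ofAlgHom (comulHom k) (counitHom k)
    (algHom_ext k (by simp) (by
      simp [TensorProduct.add_tmul, TensorProduct.tmul_add, add_assoc,
        Algebra.TensorProduct.one_def]))
    (algHom_ext k (by simp) (by simp))
    (algHom_ext k (by simp) (by simp))

theorem comul_eq (a : Sweedler k) : comul (R := k) a = comulHom k a := rfl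

theorem counit_eq (a : Sweedler k) : counit (R := k) a = counitHom k a := rfl

instance : HopfAlgebra k (Sweedler k) where
  antipode := antipodeMap k
  mul_antipode_rTensor_comul := by
    refine linearMap_ext k ?_ ?_ ?_ ?_
    all_goals simp only [LinearMap.comp_apply, comul_eq, counit_eq, map_mul, map_one]
    all_goals simp [Algebra.TensorProduct.one_def, g_mul_g, mul_add]
    all_goals (ext <;> simp [g, x])
  mul_antipode_lTensor_comul := by
    refine linearMap_ext k ?_ ?_ ?_ ?_
    all_goals simp only [LinearMap.comp_apply, comul_eq, counit_eq, map_mul, map_one]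
    all_goals simp [Algebra.TensorProduct.one_def, g_mul_g, mul_add]
    all_goals (ext <;> simp [g, x])

end Sweedler

/-- A differential graded category over `k` (cohomological grading): graded morphism spaces with a
differential of degree `1` and an associative, unital, bilinear composition satisfying the graded
Leibniz rule. `comp h b a` is the composite `b ∘ a`. -/
structure DGCat (k : Type u) [Field k] where
  Obj : Type u1
  Hom : Obj → Obj → ℤ → Type v1
  [acg : ∀ X Y n, AddCommGroup (Hom X Y n)]
  [mod : ∀ X Y n, Module k (Hom X Y n)]
  d : ∀ {X Y : Obj} {n m : ℤ}, n + 1 = m → (Hom X Y n →ₗ[k] Hom X Y m)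
  id : ∀ X : Obj, Hom X X 0
  comp : ∀ {X Y Z : Obj} {i j n : ℤ}, i + j = n →
    (Hom Y Z i →ₗ[k] Hom X Y j →ₗ[k] Hom X Z n)
  d_d : ∀ {X Y : Obj} {n m l : ℤ} (h : n + 1 = m) (h2 : m + 1 = l) (a : Hom X Y n),
    d h2 (d h a) = 0
  id_comp : ∀ {X Y : Obj} {n : ℤ} (h : 0 + n = n) (a : Hom X Y n), comp h (id Y) a = a
  comp_id : ∀ {X Y : Obj} {n : ℤ} (h : n + 0 = n) (a : Hom X Y n), comp h a (id X) = a
  assoc : ∀ {X Y Z W : Obj} {i j l ij jl n : ℤ} (hij : i + j = ij) (hjl : j + l = jl)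
    (h : ij + l = n) (h2 : i + jl = n) (c : Hom Z W i) (b : Hom Y Z j) (a : Hom X Y l),
    comp h (comp hij c b) a = comp h2 c (comp hjl b a)
  d_comp : ∀ {X Y Z : Obj} {i i2 j j2 n n2 : ℤ} (h : i + j = n) (hn : n + 1 = n2)
    (hi : i + 1 = i2) (hj : j + 1 = j2) (h1 : i2 + j = n2) (h2 : i + j2 = n2)
    (b : Hom Y Z i) (a : Hom X Y j),
    d hn (comp h b a) = comp h1 (d hi b) a + ((-1 : k) ^ i) • comp h2 b (d hj a)

namespace DGCat

attribute [instance] DGCat.acg DGCat.mod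

variable {k : Type u} [Field k]

/-- A morphism is closed if it is annihilated by the differential. -/
def Closed (C : DGCat.{u, u1, v1} k) {X Y : C.Obj} {n : ℤ} (a : C.Hom X Y n) : Prop :=
  C.d (rfl : n + 1 = n + 1) a = 0

/-- A morphism is exact if it lies in the image of the differential. -/
def Exact (C : DGCat.{u, u1, v1} k) {X Y : C.Obj} {n : ℤ} (a : C.Hom X Y n) : Prop :=
  ∃ b : C.Hom X Y (n - 1), C.d (sub_add_cancel n 1) b = a

/-- Two objects are homotopy equivalent if they are isomorphic in the category `H⁰(C)`. -/
def HomotopyEquivalent (C : DGCat.{u, u1, v1} k) (X Y : C.Obj) : Prop :=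
  ∃ (a : C.Hom X Y 0) (b : C.Hom Y X 0), C.Closed a ∧ C.Closed b ∧
    C.Exact (C.comp (add_zero 0) b a - C.id X) ∧ C.Exact (C.comp (add_zero 0) a b - C.id Y)

/-- The full DG subcategory on the objects satisfying `P`. -/
def full (C : DGCat.{u, u1, v1} k) (P : C.Obj → Prop) : DGCat.{u, u1, v1} k where
  Obj := {X : C.Obj // P X}
  Hom X Y n := C.Hom X.1 Y.1 n
  d h := C.d h
  id X := C.id X.1
  comp h := C.comp h
  d_d h h2 a := C.d_d h h2 a
  id_comp h a := C.id_comp h a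
  comp_id h a := C.comp_id h a
  assoc hij hjl h h2 c b a := C.assoc hij hjl h h2 c b a
  d_comp h hn hi hj h1 h2 b a := C.d_comp h hn hi hj h1 h2 b a

end DGCat

/-- A DG functor: a `k`-linear functor preserving degrees and differentials. -/
structure DGFunctor {k : Type u} [Field k] (C : DGCat.{u, u1, v1} k) (D : DGCat.{u, u2, v2} k) where
  obj : C.Obj → D.Obj
  map : ∀ {X Y : C.Obj} {n : ℤ}, C.Hom X Y n →ₗ[k] D.Hom (obj X) (obj Y) n
  map_d : ∀ {X Y : C.Obj} {n m : ℤ} (h : n + 1 = m) (a : C.Hom X Y n),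
    map (C.d h a) = D.d h (map a)
  map_id : ∀ X : C.Obj, map (C.id X) = D.id (obj X)
  map_comp : ∀ {X Y Z : C.Obj} {i j n : ℤ} (h : i + j = n) (b : C.Hom Y Z i) (a : C.Hom X Y j),
    map (C.comp h b a) = D.comp h (map b) (map a)

namespace DGFunctor

variable {k : Type u} [Field k] {C : DGCat.{u, u1, v1} k} {D : DGCat.{u, u2, v2} k}

/-- A DG functor is a quasi-equivalence if it induces bijections on the cohomology of all morphism
complexes (first two clauses: surjectivity and injectivity) and an essentially surjective functor
`H⁰(C) → H⁰(D)` (third clause). -/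
structure IsQuasiEquivalence (F : DGFunctor C D) : Prop where
  surj : ∀ (X Y : C.Obj) (n : ℤ) (b : D.Hom (F.obj X) (F.obj Y) n), D.Closed b →
    ∃ a : C.Hom X Y n, C.Closed a ∧ D.Exact (b - F.map a)
  inj : ∀ (X Y : C.Obj) (n : ℤ) (a : C.Hom X Y n), C.Closed a → D.Exact (F.map a) → C.Exact a
  essSurj : ∀ Y : D.Obj, ∃ X : C.Obj, D.HomotopyEquivalent (F.obj X) Y

/-- The restriction of a DG functor to full DG subcategories. -/
def restrict (F : DGFunctor C D) (P : C.Obj → Prop) (Q : D.Obj → Prop)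
    (h : ∀ X, P X → Q (F.obj X)) : DGFunctor (C.full P) (D.full Q) where
  obj X := ⟨F.obj X.1, h X.1 X.2⟩
  map := F.map
  map_d h a := F.map_d h a
  map_id X := F.map_id X.1
  map_comp h b a := F.map_comp h b a

end DGFunctor

/-- A DG algebra over `k` (cohomological grading). -/
structure DGAlgebra (k : Type u) [Field k] where
  carrier : Type v
  [ring : Ring carrier]
  [alg : Algebra k carrier]
  gr : ℤ → Submodule k carrier
  internal : DirectSum.IsInternal gr
  one_mem : (1 : carrier) ∈ gr 0
  mul_mem : ∀ {i j : ℤ} {a b : carrier}, a ∈ gr i → b ∈ gr j → a * b ∈ gr (i + j)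
  d : carrier →ₗ[k] carrier
  d_mem : ∀ {i : ℤ} {a : carrier}, a ∈ gr i → d a ∈ gr (i + 1)
  d_d : ∀ a : carrier, d (d a) = 0
  leibniz : ∀ {i : ℤ} {a : carrier} (b : carrier), a ∈ gr i →
    d (a * b) = d a * b + ((-1 : k) ^ i) • (a * d b)

attribute [instance] DGAlgebra.ring DGAlgebra.alg

/-- A (left) DG module over a DG algebra. -/
structure DGModule {k : Type u} [Field k] (A : DGAlgebra.{u, v} k) where
  carrier : Type w
  [acg : AddCommGroup carrier]
  [modk : Module k carrier]
  [modA : Module A.carrier carrier]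
  [tower : IsScalarTower k A.carrier carrier]
  gr : ℤ → Submodule k carrier
  internal : DirectSum.IsInternal gr
  smul_mem : ∀ {i j : ℤ} {a : A.carrier} {m : carrier}, a ∈ A.gr i → m ∈ gr j →
    a • m ∈ gr (i + j)
  d : carrier →ₗ[k] carrier
  d_mem : ∀ {i : ℤ} {m : carrier}, m ∈ gr i → d m ∈ gr (i + 1)
  d_d : ∀ m : carrier, d (d m) = 0
  leibniz : ∀ {i : ℤ} {a : A.carrier} (m : carrier), a ∈ A.gr i →
    d (a • m) = A.d a • m + ((-1 : k) ^ i) • (a • d m)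

namespace DGModule

attribute [instance] DGModule.acg DGModule.modk DGModule.modA DGModule.tower

variable {k : Type u} [Field k] {A : DGAlgebra.{u, v} k}

/-- The space of morphisms `f : M → N` of degree `n`, not necessarily compatible with the
differentials: `f` raises degrees by `n` and satisfies `f(am) = (-1)^{n|a|} a f(m)`. -/
def homs (M N : DGModule.{u, v, w} A) (n : ℤ) : Submodule k (M.carrier →ₗ[k] N.carrier) where
  carrier := {f | (∀ (i : ℤ) (m : M.carrier), m ∈ M.gr i → f m ∈ N.gr (i + n)) ∧
    ∀ (i : ℤ) (a : A.carrier) (m : M.carrier), a ∈ A.gr i →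
      f (a • m) = ((-1 : k) ^ (n * i)) • (a • f m)}
  add_mem' {f g} hf hg := ⟨fun i m hm => add_mem (hf.1 i m hm) (hg.1 i m hm), fun i a m ha => by
    rw [LinearMap.add_apply, hf.2 i a m ha, hg.2 i a m ha, LinearMap.add_apply, smul_add, smul_add]⟩
  zero_mem' := ⟨fun i m hm => zero_mem _, fun i a m ha => by simp⟩
  smul_mem' c f hf := ⟨fun i m hm => Submodule.smul_mem _ c (hf.1 i m hm), fun i a m ha => by
    rw [LinearMap.smul_apply, hf.2 i a m ha, LinearMap.smul_apply, 
      smul_algebra_smul_comm, smul_comm c]⟩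

theorem sign_add (i j : ℤ) : (-1 : k) ^ (i + j) = (-1) ^ i * (-1) ^ j :=
  zpow_add₀ (by simp) i j

theorem sign_sq (i : ℤ) : (-1 : k) ^ i * (-1) ^ i = 1 := by
  rw [← mul_zpow]
  simp

theorem comp_mem {M N L : DGModule.{u, v, w} A} {i j n : ℤ} (h : i + j = n)
    {b : N.carrier →ₗ[k] L.carrier} {a : M.carrier →ₗ[k] N.carrier}
    (hb : b ∈ homs N L i) (ha : a ∈ homs M N j) : b ∘ₗ a ∈ homs M L n := by
  subst h
  refine ⟨fun p m hm => ?_, fun p r m hr => ?_⟩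
  · have := hb.1 _ _ (ha.1 p m hm)
    rwa [add_assoc, add_comm j i] at this
  · rw [LinearMap.comp_apply, ha.2 p r m hr, map_smul, hb.2 p r _ hr, smul_smul, add_mul,
      sign_add, mul_comm, LinearMap.comp_apply]

theorem id_mem (M : DGModule.{u, v, w} A) : LinearMap.id ∈ homs M M 0 :=
  ⟨fun i m hm => by simpa using hm, fun i a m ha => by simp⟩

/-- `f ↦ d ∘ f - (-1)^n f ∘ d` on linear maps. -/
def dLin (M N : DGModule.{u, v, w} A) (n : ℤ) :
    (M.carrier →ₗ[k] N.carrier) →ₗ[k] (M.carrier →ₗ[k] N.carrier) where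
  toFun f := N.d ∘ₗ f - ((-1 : k) ^ n) • (f ∘ₗ M.d)
  map_add' f g := by
    ext m; simp; abel
  map_smul' c f := by
    ext m; simp [smul_sub, smul_comm c]

theorem dLin_apply (M N : DGModule.{u, v, w} A) (n : ℤ) (f : M.carrier →ₗ[k] N.carrier)
    (m : M.carrier) : dLin M N n f m = N.d (f m) - ((-1 : k) ^ n) • f (M.d m) := rfl

theorem dLin_mem {M N : DGModule.{u, v, w} A} {n m : ℤ} (h : n + 1 = m)
    {f : M.carrier →ₗ[k] N.carrier} (hf : f ∈ homs M N n) : dLin M N n f ∈ homs M N m := by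
  subst h
  refine ⟨fun p x hx => ?_, fun p r x hr => ?_⟩
  · refine sub_mem ?_ (Submodule.smul_mem _ _ ?_)
    · have := N.d_mem (hf.1 p x hx)
      rwa [add_assoc] at this
    · have := hf.1 _ _ (M.d_mem hx)
      rwa [add_assoc, add_comm 1 n] at this
  · simp only [dLin_apply, M.leibniz x hr, hf.2 p r _ hr, hf.2 _ _ x (A.d_mem hr), map_smul,
      N.leibniz _ hr, map_add, smul_add, smul_sub, add_mul, mul_add, sign_add, one_mul, mul_one]
    have hcomm (b : A.carrier) (c : k) (m : N.carrier) : b • c • m = c • b • m :=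
      smul_algebra_smul_comm c b m
    simp only [hcomm]
    generalize A.d r • f x = y1
    generalize r • N.d (f x) = y2
    generalize r • f (M.d x) = y3
    have h1 := sign_sq (k := k) n
    generalize (-1 : k) ^ n = s at *
    generalize (-1 : k) ^ (n * p) = t
    generalize (-1 : k) ^ p = q
    have h2 : s • (t * s) • y1 = t • y1 := by
      rw [smul_smul, mul_left_comm, h1, mul_one]
    rw [h2]
    module

end DGModule

open DGModule in
/-- The DG category of DG modules over a DG algebra: the morphism complex from `M` to `N` is in
degree `n` the space `DGModule.homs M N n`, with differential `d f = d ∘ f - (-1)^n f ∘ d`. -/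
def dgMod {k : Type u} [Field k] (A : DGAlgebra.{u, v} k) : DGCat.{u, max u v (w + 1), w} k where
  Obj := DGModule.{u, v, w} A
  Hom M N n := homs M N n
  d {M N n m} h := (dLin M N n).restrict fun f hf => dLin_mem h hf
  id M := ⟨LinearMap.id, id_mem M⟩
  comp {M N L i j n} h := LinearMap.mk₂ k (fun b a => ⟨b.1 ∘ₗ a.1, comp_mem h b.2 a.2⟩)
    (fun _ _ _ => rfl) (fun _ _ _ => rfl)
    (fun b a a2 => Subtype.ext (LinearMap.comp_add _ _ _))
    (fun c b a => Subtype.ext (LinearMap.comp_smul _ _ _))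
  d_d {M N n m l} h h2 f := by
    subst h
    refine Subtype.ext (LinearMap.ext fun x => ?_)
    change dLin M N (n + 1) (dLin M N n f.1) x = 0
    simp [dLin_apply, N.d_d, M.d_d, sign_add]
  id_comp h a := rfl
  comp_id h a := rfl
  assoc hij hjl h h2 c b a := rfl
  d_comp {M N L i i2 j j2 n n2} h hn hi hj h1 h2 b a := by
    subst h
    refine Subtype.ext (LinearMap.ext fun x => ?_)
    change dLin M L (i + j) (b.1 ∘ₗ a.1) x =
      dLin N L i b.1 (a.1 x) + ((-1 : k) ^ i) • b.1 (dLin M N j a.1 x)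
    simp [dLin_apply, sign_add, smul_sub, smul_smul]

namespace DGModule

variable {k : Type u} [Field k] {A : DGAlgebra.{u, v} k}

/-- A DG module is acyclic if its cohomology vanishes. -/
def Acyclic (M : DGModule.{u, v, w} A) : Prop := ∀ m : M.carrier, M.d m = 0 → ∃ l, M.d l = m

/-- A DG module `M` is h-projective if every morphism complex from `M` to an acyclic DG module is
acyclic. -/
def HProjective (M : DGModule.{u, v, w} A) : Prop :=
  ∀ N : DGModule.{u, v, w} A, N.Acyclic →
    ∀ (n : ℤ) (f : (dgMod.{u, v, w} A).Hom M N n), (dgMod A).Closed f → (dgMod A).Exact f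

/-- A closed morphism of degree `0` is a quasi-isomorphism if it induces a bijection on cohomology
(surjectivity and injectivity, respectively). -/
def QuasiIso {M N : DGModule.{u, v, w} A} (f : (dgMod.{u, v, w} A).Hom M N 0) : Prop :=
  (∀ y : N.carrier, N.d y = 0 → ∃ x, M.d x = 0 ∧ ∃ l, N.d l = y - f.1 x) ∧
    ∀ x : M.carrier, M.d x = 0 → (∃ l, N.d l = f.1 x) → ∃ l, M.d l = x

end DGModule

namespace DGAlgebra

variable (k : Type u) [Field k] (R : Type v) [Ring R] [Algebra k R]

/-- The grading of `R[θ] = R ⊕ Rθ`: the elements of `R` have degree `0`, those of `Rθ` have degree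
`-1`, and all other graded pieces vanish. -/
def thetaGr (n : ℤ) : Submodule k (DualNumber R) where
  carrier := {a | (n ≠ 0 → a.fst = 0) ∧ (n ≠ -1 → a.snd = 0)}
  add_mem' {a b} ha hb := ⟨fun h => by simp [ha.1 h, hb.1 h], fun h => by simp [ha.2 h, hb.2 h]⟩
  zero_mem' := ⟨fun _ => rfl, fun _ => rfl⟩
  smul_mem' c a ha := ⟨fun h => by simp [ha.1 h], fun h => by simp [ha.2 h]⟩

theorem mem_thetaGr {n : ℤ} {a : DualNumber R} :
    a ∈ thetaGr k R n ↔ (n ≠ 0 → a.fst = 0) ∧ (n ≠ -1 → a.snd = 0) := Iff.rfl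

theorem inl_mem_thetaGr (r : R) : (TrivSqZeroExt.inl r : DualNumber R) ∈ thetaGr k R 0 :=
  ⟨fun h => absurd rfl h, fun _ => rfl⟩

theorem inr_mem_thetaGr (r : R) : (TrivSqZeroExt.inr r : DualNumber R) ∈ thetaGr k R (-1) :=
  ⟨fun _ => rfl, fun h => absurd rfl h⟩

/-- The decomposition of `a + bθ` into its components. -/
def thetaDec : DualNumber R →+ DirectSum ℤ fun n => thetaGr k R n where
  toFun a := DirectSum.of (fun n => thetaGr k R n) 0 ⟨.inl a.fst, inl_mem_thetaGr k R _⟩ +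
    DirectSum.of (fun n => thetaGr k R n) (-1) ⟨.inr a.snd, inr_mem_thetaGr k R _⟩
  map_zero' := by
    have h0 : (⟨.inl 0, inl_mem_thetaGr k R 0⟩ : thetaGr k R 0) = 0 := rfl
    have h1 : (⟨.inr 0, inr_mem_thetaGr k R 0⟩ : thetaGr k R (-1)) = 0 := rfl
    rw [TrivSqZeroExt.fst_zero, TrivSqZeroExt.snd_zero, h0, h1, map_zero, map_zero, add_zero]
  map_add' a b := by
    have h0 : (⟨.inl (a + b).fst, inl_mem_thetaGr k R _⟩ : thetaGr k R 0) =
        ⟨.inl a.fst, inl_mem_thetaGr k R _⟩ + ⟨.inl b.fst, inl_mem_thetaGr k R _⟩ :=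
      Subtype.ext (TrivSqZeroExt.inl_add _ _ _)
    have h1 : (⟨.inr (a + b).snd, inr_mem_thetaGr k R _⟩ : thetaGr k R (-1)) =
        ⟨.inr a.snd, inr_mem_thetaGr k R _⟩ + ⟨.inr b.snd, inr_mem_thetaGr k R _⟩ :=
      Subtype.ext (TrivSqZeroExt.inr_add _ _ _)
    rw [h0, h1, map_add, map_add]
    abel

theorem thetaDec_apply (a : DualNumber R) : thetaDec k R a =
    DirectSum.of (fun n => thetaGr k R n) 0 ⟨.inl a.fst, inl_mem_thetaGr k R _⟩ +
      DirectSum.of (fun n => thetaGr k R n) (-1) ⟨.inr a.snd, inr_mem_thetaGr k R _⟩ := rfl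

theorem thetaGr_internal : DirectSum.IsInternal (thetaGr k R) := by
  classical
  refine (DirectSum.Decomposition.ofAddHom (thetaGr k R) (thetaDec k R) ?_ ?_).isInternal
  · refine AddMonoidHom.ext fun a => ?_
    rw [AddMonoidHom.comp_apply, thetaDec_apply, map_add, DirectSum.coeAddMonoidHom_of,
      DirectSum.coeAddMonoidHom_of]
    exact TrivSqZeroExt.inl_fst_add_inr_snd_eq a
  · refine DirectSum.addHom_ext fun n a => ?_
    obtain ⟨a, ha⟩ := a
    rw [AddMonoidHom.comp_apply, DirectSum.coeAddMonoidHom_of, AddMonoidHom.id_apply]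
    change thetaDec k R a = _
    rw [thetaDec_apply]
    by_cases h : n = 0
    · subst h
      have h0 : (⟨.inl a.fst, inl_mem_thetaGr k R _⟩ : thetaGr k R 0) = ⟨a, ha⟩ :=
        Subtype.ext (TrivSqZeroExt.ext rfl (ha.2 (by omega)).symm)
      have h1 : (⟨.inr a.snd, inr_mem_thetaGr k R _⟩ : thetaGr k R (-1)) = 0 :=
        Subtype.ext (TrivSqZeroExt.ext rfl (ha.2 (by omega)))
      rw [h0, h1, map_zero, add_zero]
    · by_cases h2 : n = -1
      · subst h2
        have h0 : (⟨.inr a.snd, inr_mem_thetaGr k R _⟩ : thetaGr k R (-1)) = ⟨a, ha⟩ :=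
          Subtype.ext (TrivSqZeroExt.ext (ha.1 h).symm rfl)
        have h1 : (⟨.inl a.fst, inl_mem_thetaGr k R _⟩ : thetaGr k R 0) = 0 :=
          Subtype.ext (TrivSqZeroExt.ext (ha.1 h) rfl)
        rw [h0, h1, map_zero, zero_add]
      · obtain rfl : a = 0 := TrivSqZeroExt.ext (ha.1 h) (ha.2 h2)
        have h3 : (⟨0, ha⟩ : thetaGr k R n) = 0 := rfl
        rw [h3, map_zero, ← thetaDec_apply, map_zero]

/-- For a central element `z` of `R`, the DG algebra `R[θ]` obtained by adjoining a graded
commutative variable `θ` of degree `-1` (so that `θ² = 0` and `rθ = θr`), with `d = 0` on `R` and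
`dθ = z`. The underlying algebra is that of dual numbers `a + bθ` over `R`. -/
def adjoinTheta (z : R) (hz : ∀ r : R, z * r = r * z) : DGAlgebra.{u, v} k where
  carrier := DualNumber R
  gr := thetaGr k R
  internal := thetaGr_internal k R
  one_mem := by simp [mem_thetaGr]
  mul_mem {i j a b} ha hb := by
    rw [mem_thetaGr] at *
    refine ⟨fun h => ?_, fun h => ?_⟩
    · rw [TrivSqZeroExt.fst_mul]
      by_cases hi : i = 0
      · rw [hb.1 (by omega), mul_zero]
      · rw [ha.1 hi, zero_mul]
    · rw [DualNumber.snd_mul]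
      by_cases hi : i = 0
      · rw [hb.2 (by omega), ha.2 (by omega)]
        simp
      · rw [ha.1 hi, zero_mul, zero_add]
        by_cases hj : j = 0
        · rw [ha.2 (by omega), zero_mul]
        · rw [hb.1 hj, mul_zero]
  d :=
    { toFun := fun a => TrivSqZeroExt.inl (a.snd * z)
      map_add' := fun a b => by ext <;> simp [add_mul]
      map_smul' := fun c a => by ext <;> simp }
  d_mem {i a} ha := by
    rw [mem_thetaGr] at *
    refine ⟨fun h => ?_, fun h => rfl⟩
    simp [ha.2 (by omega)]
  d_d a := by ext <;> simp
  leibniz {i a} b ha := by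
    rw [mem_thetaGr] at ha
    refine TrivSqZeroExt.ext ?_ ?_
    · by_cases hi : i = 0
      · subst hi
        simp [ha.2 (by omega), mul_assoc]
      · simp [ha.1 hi, mul_assoc, hz]
    · by_cases hi : i = -1
      · subst hi
        simp [mul_assoc, hz]
      · simp [ha.2 hi]

end DGAlgebra

namespace TwistedDouble

variable (k : Type u) [Field k]

/-- The element `g = ε(-) g` of the twisted double of Sweedler's algebra `H`, the image of the
grouplike generator under `H → End(H)`, `h ↦ ε(-) h`. -/
def gEl : TwistedDouble k (Sweedler k) :=
  of k _ ((Coalgebra.counit : Sweedler k →ₗ[k] k).smulRight (Sweedler.g k))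

/-- The character `χ` of Sweedler's algebra with `χ(g) = -1` and `χ(x) = 0`. It is the element of the
dual Hopf algebra corresponding to `g` under the isomorphism of Sweedler's algebra with its dual. -/
def chi : Sweedler k →ₐ[k] k :=
  QuaternionAlgebra.lift
    { i := -1
      j := 0
      k := 0
      i_mul_i := by simp
      j_mul_j := by simp
      i_mul_j := by simp
      j_mul_i := by simp }

/-- The element `g' = χ(-) 1` of the twisted double of Sweedler's algebra `H`, the image of `χ` under
`H* → End(H)`, `χ ↦ χ(-) 1`. -/
def gDual : TwistedDouble k (Sweedler k) :=
  of k _ ((chi k).toLinearMap.smulRight (1 : Sweedler k))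

end TwistedDouble

/-- The quotient of a ring by the two-sided ideal generated by `a`. -/
abbrev quotientBy {R : Type v} [Ring R] (a : R) : Type v := (TwoSidedIdeal.span {a}).ringCon.Quotient

open TwistedDouble in
/-- The block `D_s` of the twisted double of Sweedler's algebra: the quotient by `gg' - (-1)^s`. -/
abbrev DBlock (k : Type u) [Field k] (s : ℕ) : Type u :=
  quotientBy (gEl k * gDual k - (-1) ^ s)

/-- The image of `σ - 1` in the block `D_s`. -/
def sigmaSubOne (k : Type u) [Field k] (s : ℕ) : DBlock k s :=
  ((TwistedDouble.sigma k (Sweedler k) - 1 : TwistedDouble k (Sweedler k)) : DBlock k s)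

theorem sigmaSubOne_comm (k : Type u) [Field k] (s : ℕ) (r : DBlock k s) :
    sigmaSubOne k s * r = r * sigmaSubOne k s := by
  induction r using Quotient.inductionOn with
  | _ r =>
    have h : (TwistedDouble.sigma k (Sweedler k) - 1) * r =
        r * (TwistedDouble.sigma k (Sweedler k) - 1) := by
      rw [sub_mul, mul_sub, TwistedDouble.sigma_comm, one_mul, mul_one]
    exact congrArg (RingCon.toQuotient (c := (TwoSidedIdeal.span
      {TwistedDouble.gEl k * TwistedDouble.gDual k - (-1) ^ s}).ringCon)) h

/-- The DG algebra `D_s[θ]` with `dθ = σ - 1`. -/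
def DBlockTheta (k : Type u) [Field k] (s : ℕ) : DGAlgebra.{u, u} k :=
  DGAlgebra.adjoinTheta k (DBlock k s) (sigmaSubOne k s) (sigmaSubOne_comm k s)

/-- The DG category `C_s` of DG modules over `D_s[θ]`. -/
def CBlock (k : Type u) [Field k] (s : ℕ) : DGCat.{u, max u (w + 1), w} k :=
  dgMod.{u, u, w} (DBlockTheta k s)

/-- The DG algebra `k[θ]` with `dθ = 0`. -/
def kTheta (k : Type u) [Field k] : DGAlgebra.{u, u} k :=
  DGAlgebra.adjoinTheta k k 0 (fun r => by simp)

/-- The DG category of mixed complexes: DG modules over `k[θ]`. -/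
def mixedComplexes (k : Type u) [Field k] : DGCat.{u, max u (w + 1), w} k :=
  dgMod.{u, u, w} (kTheta k)

end

/-! Write z = σ - 1. In D_0 one has σ² = 1, and the central idempotent (1 + σ)/2 splits D_0 into two
factors. On the first, z = 0 and the factor is the algebra of 2 × 2 matrices over k; on the second,
z = -2 is invertible. The structure `MatrixBlock` records what is needed of such a splitting of a
ring R: matrix units `E i j`, the projection `rho` onto the matrix factor, and a scalar c with 1 - ∑
E i i = cz.

On every DG module over R[θ] the operators satisfy dθ + θd = z. Hence cθ is a homotopy from 0 to the
projection onto the second factor, and that factor contributes nothing to cohomology. On the first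
factor Morita theory applies: a module is recovered from its corner, the image of a primitive
idempotent `E o o`, as the column vectors with entries in the corner. Since z kills the corner, the
corner is a mixed complex. The functor of the theorem is the passage to the corner.

The corner functor is strictly surjective on closed morphisms (`exists_closed_cornerHom`), with a
section given by acting entry by entry. It is injective on cohomology because a primitive on corners
plus cθ composed with the morphism is a primitive of the morphism (`exists_homotopy`). It is
essentially surjective because the corner of the column vectors over Y is isomorphic to Y
(`homotopyEquivalent_corner_power`). Corner and column vectors are adjoint on both sides and both
preserve acyclicity, so both preserve h-projectivity (`hProjective_corner`, `hProjective_power`).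

The same splitting gives R/z ≅ matrices, hence the equivalence of module categories, and the
relation cz² = z, hence diagonalizability. What remains is a computation in the 16-dimensional
twisted double: `rhoLin_star`, `star_matrixUnit`, `matrixUnit_star` and `one_sub_matrixUnit` exhibit
the matrix factor, with c = -1/2. -/

noncomputable section

open scoped TensorProduct Quaternion

open Coalgebra HopfAlgebra

/-! ### Internally graded vector spaces: retracts and finite powers. -/

section Graded

variable {k : Type*} [Field k] {V W : Type*} [AddCommGroup V] [Module k V]
  [AddCommGroup W] [Module k W]

/-- The map of external direct sums induced by a map of graded vector spaces. -/
def gradedMap (grV : ℤ → Submodule k V) (grW : ℤ → Submodule k W) (f : V →ₗ[k] W)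
    (hf : ∀ n, ∀ m ∈ grV n, f m ∈ grW n) :
    (DirectSum ℤ fun n => grV n) →ₗ[k] DirectSum ℤ fun n => grW n :=
  DirectSum.lmap fun n => f.restrict (hf n)

theorem coe_gradedMap_apply {grV : ℤ → Submodule k V} {grW : ℤ → Submodule k W} {f : V →ₗ[k] W}
    (hf : ∀ n, ∀ m ∈ grV n, f m ∈ grW n) (x : DirectSum ℤ fun n => grV n) (n : ℤ) :
    (gradedMap grV grW f hf x n : W) = f (x n) := rfl

theorem coeAddMonoidHom_gradedMap {grV : ℤ → Submodule k V} {grW : ℤ → Submodule k W}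
    {f : V →ₗ[k] W} (hf : ∀ n, ∀ m ∈ grV n, f m ∈ grW n) (x : DirectSum ℤ fun n => grV n) :
    DirectSum.coeAddMonoidHom grW (gradedMap grV grW f hf x) =
      f (DirectSum.coeAddMonoidHom grV x) := by
  induction x using DirectSum.induction_on with
  | zero => simp
  | of n m =>
    have : gradedMap grV grW f hf (DirectSum.of (fun n => grV n) n m) =
        DirectSum.of (fun n => grW n) n ⟨f m, hf n m m.2⟩ :=
      DirectSum.lmap_lof (fun n => f.restrict (hf n)) n m
    rw [this, DirectSum.coeAddMonoidHom_of, DirectSum.coeAddMonoidHom_of]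
  | add x y hx hy => simp only [map_add, hx, hy]

/-- A retract of a graded vector space is graded. -/
theorem isInternal_of_retract {grV : ℤ → Submodule k V} {grW : ℤ → Submodule k W}
    (hV : DirectSum.IsInternal grV) (i : W →ₗ[k] V) (q : V →ₗ[k] W) (hqi : ∀ y, q (i y) = y)
    (hi : ∀ n, ∀ m ∈ grW n, i m ∈ grV n) (hq : ∀ n, ∀ m ∈ grV n, q m ∈ grW n) :
    DirectSum.IsInternal grW := by
  refine ⟨(injective_iff_map_eq_zero _).2 fun x hx => ?_, fun y => ?_⟩
  · have h : gradedMap grW grV i hi x = 0 := by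
      refine (injective_iff_map_eq_zero _).1 hV.1 _ ?_
      rw [coeAddMonoidHom_gradedMap, hx, map_zero]
    refine DFinsupp.ext fun n => Subtype.ext ?_
    -- Injectivity is tested degree by degree: `i` is injective because it has the retraction `q`.
    have h2 : i (x n) = 0 := by
      rw [← coe_gradedMap_apply hi, h]
      rfl
    have h3 := hqi (x n)
    rw [h2, map_zero] at h3
    exact h3.symm
  · obtain ⟨x, hx⟩ := hV.2 (i y)
    exact ⟨gradedMap grV grW q hq x, by rw [coeAddMonoidHom_gradedMap, hx, hqi]⟩

/-- A finite power of a graded vector space is graded. -/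
theorem isInternal_pi {ι : Type*} [Fintype ι] [DecidableEq ι] {grV : ℤ → Submodule k V}
    (hV : DirectSum.IsInternal grV) :
    DirectSum.IsInternal fun n => Submodule.pi (Set.univ : Set ι) fun _ => grV n := by
  have hp (j : ι) (n : ℤ) (m : ι → V) (hm : m ∈ Submodule.pi (Set.univ : Set ι) fun _ => grV n) :
      LinearMap.proj (R := k) (φ := fun _ : ι => V) j m ∈ grV n := hm j trivial
  have hs (j : ι) (n : ℤ) (m : V) (hm : m ∈ grV n) :
      LinearMap.single k (fun _ : ι => V) j m ∈ Submodule.pi (Set.univ : Set ι) fun _ => grV n := by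
    intro l _
    by_cases h : l = j
    · subst h; simpa using hm
    · simp [h]
  refine ⟨(injective_iff_map_eq_zero _).2 fun x hx => ?_, fun y => ?_⟩
  · refine DFinsupp.ext fun n => Subtype.ext (funext fun j => ?_)
    have h : gradedMap _ grV _ (hp j) x = 0 := by
      refine (injective_iff_map_eq_zero _).1 hV.1 _ ?_
      rw [coeAddMonoidHom_gradedMap, hx, map_zero]
    have h2 := coe_gradedMap_apply (hp j) x n
    rw [h] at h2
    exact h2.symm
  · choose x hx using fun j => hV.2 (y j)
    refine ⟨∑ j, gradedMap grV _ _ (hs j) (x j), ?_⟩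
    simp only [map_sum, coeAddMonoidHom_gradedMap, hx]
    exact Finset.univ_sum_single y

end Graded

/-! ### DG modules over R[θ] as complexes with operators. -/

namespace DGAlgebra

variable {k : Type u} [Field k] {R : Type v} [Ring R] [Algebra k R] {z : R}
  (hz : ∀ r : R, z * r = r * z)

/-- The inclusion of `R` into `R[θ]`. -/
def inlAdjoin : R →ₐ[k] (adjoinTheta k R z hz).carrier := TrivSqZeroExt.inlAlgHom k R R

/-- The element `rθ` of `R[θ]`. -/
def inrAdjoin (r : R) : (adjoinTheta k R z hz).carrier := (TrivSqZeroExt.inr r : DualNumber R)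

theorem adjoin_eq (a : (adjoinTheta k R z hz).carrier) : a =
    inlAdjoin (k := k) hz (TrivSqZeroExt.fst (a : DualNumber R)) +
      inlAdjoin (k := k) hz (TrivSqZeroExt.snd (a : DualNumber R)) * inrAdjoin (k := k) hz 1 := by
  have (b : DualNumber R) : b = TrivSqZeroExt.inl b.fst +
      TrivSqZeroExt.inl b.snd * TrivSqZeroExt.inr 1 := by
    refine TrivSqZeroExt.ext ?_ ?_ <;> simp
  exact this a

end DGAlgebra

namespace DGModule

open DGAlgebra

section Operators

variable {k : Type u} [Field k] {R : Type v} [Ring R] [Algebra k R] {z : R}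
  {hz : ∀ r : R, z * r = r * z}

/-- The action of the elements of `R` on a DG module over `R[θ]`. -/
def act (M : DGModule.{u, v, w} (adjoinTheta k R z hz)) : R →ₐ[k] Module.End k M.carrier :=
  (Algebra.lsmul k k M.carrier).comp (inlAdjoin hz)

/-- The action of `θ` on a DG module over `R[θ]`. -/
def theta (M : DGModule.{u, v, w} (adjoinTheta k R z hz)) : Module.End k M.carrier :=
  Algebra.lsmul k k M.carrier (inrAdjoin (k := k) hz 1)

variable (M N : DGModule.{u, v, w} (adjoinTheta k R z hz))

theorem act_def (r : R) (m : M.carrier) : M.act r m = inlAdjoin (k := k) hz r • m := rfl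

theorem theta_def (m : M.carrier) : M.theta m = inrAdjoin (k := k) hz 1 • m := rfl

theorem smul_eq (a : (adjoinTheta k R z hz).carrier) (m : M.carrier) :
    a • m = M.act (TrivSqZeroExt.fst (a : DualNumber R)) m +
      M.act (TrivSqZeroExt.snd (a : DualNumber R)) (M.theta m) := by
  conv_lhs => rw [adjoin_eq hz a]
  rw [add_smul, mul_smul]
  rfl

variable {M N}

theorem act_mul_apply (r s : R) (m : M.carrier) : M.act (r * s) m = M.act r (M.act s m) := by
  rw [map_mul]; rfl

theorem act_mem {r : R} {i : ℤ} {m : M.carrier} (hm : m ∈ M.gr i) : M.act r m ∈ M.gr i := by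
  have := M.smul_mem (inl_mem_thetaGr k R r) hm
  rwa [zero_add] at this

theorem theta_mem {i j : ℤ} (h : -1 + i = j) {m : M.carrier} (hm : m ∈ M.gr i) :
    M.theta m ∈ M.gr j := by
  subst h
  exact M.smul_mem (inr_mem_thetaGr k R 1) hm

theorem theta_theta (m : M.carrier) : M.theta (M.theta m) = 0 := by
  rw [theta_def, theta_def, ← mul_smul]
  have : inrAdjoin (k := k) hz 1 * inrAdjoin (k := k) hz 1 = 0 :=
    TrivSqZeroExt.inr_mul_inr R (1 : R) 1
  rw [this, zero_smul]

theorem theta_act (r : R) (m : M.carrier) : M.theta (M.act r m) = M.act r (M.theta m) := by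
  rw [theta_def, theta_def, act_def, act_def, ← mul_smul, ← mul_smul]
  congr 1
  have : (TrivSqZeroExt.inr 1 * TrivSqZeroExt.inl r : DualNumber R) =
      TrivSqZeroExt.inl r * TrivSqZeroExt.inr 1 := by
    rw [TrivSqZeroExt.inr_mul_inl, TrivSqZeroExt.inl_mul_inr, smul_eq_mul, mul_one,
      op_smul_eq_mul, one_mul]
  exact this

theorem d_act (r : R) (m : M.carrier) : M.d (M.act r m) = M.act r (M.d m) := by
  have h := M.leibniz m (inl_mem_thetaGr k R r)
  have h0 : (adjoinTheta k R z hz).d (inlAdjoin (k := k) hz r) = 0 := by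
    change (TrivSqZeroExt.inl (0 * z) : DualNumber R) = 0
    simp
  rw [act_def, act_def]
  refine h.trans ?_
  change (adjoinTheta k R z hz).d (inlAdjoin (k := k) hz r) • m + _ = _
  rw [h0, zero_smul, zero_add, zpow_zero, one_smul]
  rfl

/-- This is the Leibniz rule for θ, of degree -1, with dθ = z. It says that the action of z is
null-homotopic, with homotopy θ; the contraction of the complementary factor rests on this. -/
theorem d_theta (m : M.carrier) : M.d (M.theta m) = M.act z m - M.theta (M.d m) := by
  have h := M.leibniz m (inr_mem_thetaGr k R 1)
  have h0 : (adjoinTheta k R z hz).d (inrAdjoin (k := k) hz 1) = inlAdjoin hz z := by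
    change (TrivSqZeroExt.inl (1 * z) : DualNumber R) = TrivSqZeroExt.inl z
    simp
  rw [theta_def, theta_def, act_def]
  refine h.trans ?_
  change (adjoinTheta k R z hz).d (inrAdjoin (k := k) hz 1) • m + _ = _
  rw [h0, zpow_neg_one, inv_neg, inv_one, neg_one_smul, sub_eq_add_neg]
  rfl

/-- R[θ] is generated by R in degree 0 and θ in degree -1 and is zero in all other degrees, so the
sign rule only has to be tested on these generators. The sign for θ is (-1)^(-n) = (-1)^n. -/
theorem mem_homs_iff {n : ℤ} {f : M.carrier →ₗ[k] N.carrier} : f ∈ homs M N n ↔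
    (∀ (i : ℤ) (m : M.carrier), m ∈ M.gr i → f m ∈ N.gr (i + n)) ∧
      (∀ r m, f (M.act r m) = N.act r (f m)) ∧
        ∀ m, f (M.theta m) = ((-1 : k) ^ n) • N.theta (f m) := by
  refine ⟨fun h => ⟨h.1, fun r m => ?_, fun m => ?_⟩, fun h => ⟨h.1, fun i a m ha => ?_⟩⟩
  · have := h.2 0 _ m (inl_mem_thetaGr k R r)
    rwa [mul_zero, zpow_zero, one_smul] at this
  · have := h.2 (-1) _ m (inr_mem_thetaGr k R 1)
    rwa [mul_neg, mul_one, zpow_neg, ← inv_zpow, inv_neg, inv_one] at this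
  · rw [smul_eq, smul_eq, map_add, h.2.1, h.2.1, h.2.2]
    by_cases hi : i = 0
    · subst hi
      rw [ha.2 (by omega)]
      simp
    · rw [ha.1 hi]
      by_cases hi : i = -1
      · subst hi
        rw [mul_neg, mul_one, zpow_neg, ← inv_zpow, inv_neg, inv_one]
        simp
      · rw [ha.2 hi]
        simp

end Operators

section OfAct

variable {k : Type u} [Field k] {R : Type v} [Ring R] [Algebra k R] {z : R}
  (hz : ∀ r : R, z * r = r * z) {V : Type w} [AddCommGroup V] [Module k V]
  (a : R →ₐ[k] Module.End k V) (t : Module.End k V)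

/-- The action of `R[θ]` given by an action `a` of `R` and a commuting endomorphism `t` of
square zero. -/
def thetaActHom (htt : t * t = 0) (hta : ∀ r, Commute t (a r)) :
    (adjoinTheta k R z hz).carrier →ₐ[k] Module.End k V :=
  DualNumber.lift (A := R) ⟨(a, t), htt, hta⟩

theorem thetaActHom_apply (htt : t * t = 0) (hta : ∀ r, Commute t (a r))
    (b : (adjoinTheta k R z hz).carrier) :
    thetaActHom hz a t htt hta b = a (TrivSqZeroExt.fst (b : DualNumber R)) +
      a (TrivSqZeroExt.snd (b : DualNumber R)) * t :=
  DualNumber.lift_apply_apply (A := R) _ _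

/-- A DG module over `R[θ]` is a complex with an action of `R` by chain maps and an endomorphism
`t` of degree `-1` and square zero, commuting with `R`, such that `dt + td = z`. -/
def ofAct (htt : t * t = 0) (hta : ∀ r, Commute t (a r)) (gr : ℤ → Submodule k V)
    (internal : DirectSum.IsInternal gr) (ha : ∀ r i, ∀ m ∈ gr i, a r m ∈ gr i)
    (ht : ∀ i j, -1 + i = j → ∀ m ∈ gr i, t m ∈ gr j) (d : Module.End k V)
    (hd : ∀ i, ∀ m ∈ gr i, d m ∈ gr (i + 1)) (hdd : ∀ m, d (d m) = 0)
    (hda : ∀ r m, d (a r m) = a r (d m)) (hdt : ∀ m, d (t m) = a z m - t (d m)) :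
    DGModule.{u, v, w} (adjoinTheta k R z hz) :=
  letI : Module (adjoinTheta k R z hz).carrier V :=
    Module.compHom V (thetaActHom hz a t htt hta).toRingHom
  have hsmul (b : (adjoinTheta k R z hz).carrier) (m : V) :
      b • m = a (TrivSqZeroExt.fst (b : DualNumber R)) m +
        a (TrivSqZeroExt.snd (b : DualNumber R)) (t m) :=
    congrArg (fun f : Module.End k V => f m) (thetaActHom_apply hz a t htt hta b)
  { carrier := V
    tower := ⟨fun c b m => by
      change thetaActHom hz a t htt hta (c • b) m = c • thetaActHom hz a t htt hta b m
      rw [map_smul]; rfl⟩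
    gr := gr
    internal := internal
    smul_mem := by
      intro i j b m hb hm
      rw [hsmul]
      by_cases hi : i = 0
      · subst hi
        rw [hb.2 (by omega), map_zero, LinearMap.zero_apply, add_zero, zero_add]
        exact ha _ _ _ hm
      · rw [hb.1 hi, map_zero, LinearMap.zero_apply, zero_add]
        by_cases hi : i = -1
        · subst hi
          exact ha _ _ _ (ht _ _ rfl _ hm)
        · rw [hb.2 hi, map_zero, LinearMap.zero_apply]
          exact zero_mem _
    d := d
    d_mem := fun {i m} => hd i m
    d_d := hdd
    leibniz := by
      intro i b m hb
      have hdb : (adjoinTheta k R z hz).d b • m =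
          a (TrivSqZeroExt.snd (b : DualNumber R)) (a z m) := by
        rw [hsmul]
        change a (TrivSqZeroExt.snd (b : DualNumber R) * z) m + a 0 (t m) = _
        simp
      rw [hdb, hsmul, hsmul]
      by_cases hi : i = 0
      · subst hi
        rw [hb.2 (by omega)]
        simp [hda]
      · rw [hb.1 hi]
        by_cases hi : i = -1
        · subst hi
          simp [hda, hdt, sub_eq_add_neg]
        · rw [hb.2 hi]
          simp }

variable {hz} {a t} {htt : t * t = 0} {hta : ∀ r, Commute t (a r)} {gr : ℤ → Submodule k V}
    {internal : DirectSum.IsInternal gr} {ha : ∀ r i, ∀ m ∈ gr i, a r m ∈ gr i}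
    {ht : ∀ i j, -1 + i = j → ∀ m ∈ gr i, t m ∈ gr j} {d : Module.End k V}
    {hd : ∀ i, ∀ m ∈ gr i, d m ∈ gr (i + 1)} {hdd : ∀ m, d (d m) = 0}
    {hda : ∀ r m, d (a r m) = a r (d m)} {hdt : ∀ m, d (t m) = a z m - t (d m)}

theorem ofAct_act (r : R) (m : V) :
    (ofAct hz a t htt hta gr internal ha ht d hd hdd hda hdt).act r m = a r m := by
  refine (congrArg (fun f : Module.End k V => f m)
    (thetaActHom_apply hz a t htt hta (inlAdjoin (k := k) hz r))).trans ?_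
  change a r m + a 0 (t m) = _
  simp

theorem ofAct_theta (m : V) :
    (ofAct hz a t htt hta gr internal ha ht d hd hdd hda hdt).theta m = t m := by
  refine (congrArg (fun f : Module.End k V => f m)
    (thetaActHom_apply hz a t htt hta (inrAdjoin (k := k) hz 1))).trans ?_
  change a 0 m + a 1 (t m) = _
  simp

end OfAct

end DGModule

/-! ### Matrix factors of R and the corner of a DG module. -/

/-- The DG algebra `k[θ]` with `dθ = 0`. -/
abbrev DGAlgebra.mixedAlg (k : Type u) [Field k] : DGAlgebra.{u, u} k :=
  DGAlgebra.adjoinTheta k k 0 fun r => by simp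

/-- A direct factor of `R` isomorphic to a matrix algebra over `k`, with matrix units `E i j` and
projection `rho`, on which the element `z` vanishes, and such that `z` is the inverse of the scalar
`c` on the complementary factor. -/
structure MatrixBlock (k : Type u) [Field k] (R : Type v) [Ring R] [Algebra k R] (z : R)
    (ι : Type) [Fintype ι] [DecidableEq ι] where
  rho : R →ₐ[k] Matrix ι ι k
  E : ι → ι → R
  rho_E : ∀ i j, rho (E i j) = Matrix.single i j 1
  mul_E : ∀ r i j, r * E i j = ∑ l, rho r l i • E l j
  E_mul : ∀ r i j, E i j * r = ∑ l, rho r j l • E i l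
  rho_z : rho z = 0
  c : k
  one_sub_sum_E : 1 - ∑ i, E i i = c • z

namespace MatrixBlock

open DGAlgebra DGModule

variable {k : Type u} [Field k] {R : Type v} [Ring R] [Algebra k R] {z : R}
  {ι : Type} [Fintype ι] [DecidableEq ι] (B : MatrixBlock k R z ι)

theorem E_mul_E (i j l : ι) : B.E i j * B.E j l = B.E i l := by
  rw [B.mul_E]
  simp [B.rho_E, Matrix.single_apply]

theorem E_mul_E_of_ne {i j l m : ι} (h : j ≠ l) : B.E i j * B.E l m = 0 := by
  rw [B.mul_E]
  simp [B.rho_E, h]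

/-- Left multiplication on the span of the matrix units factors through `rho`, which kills z. -/
theorem z_mul_E (i j : ι) : z * B.E i j = 0 := by
  rw [B.mul_E]
  simp [B.rho_z]

section DG

variable {hz : ∀ r : R, z * r = r * z} (o : ι)
  (M N : DGModule.{u, v, w} (adjoinTheta k R z hz))

/-- The part of `M` fixed by the primitive idempotent `E o o`. -/
def corner : Submodule k M.carrier := LinearMap.eqLocus (M.act (B.E o o)) LinearMap.id

variable {M} in
theorem mem_corner {m : M.carrier} : m ∈ B.corner o M ↔ M.act (B.E o o) m = m := Iff.rfl

theorem act_E_mem_corner (j : ι) (m : M.carrier) : M.act (B.E o j) m ∈ B.corner o M := by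
  rw [mem_corner, ← act_mul_apply, E_mul_E]

/-- The grading of the corner. -/
def cornerGr (n : ℤ) : Submodule k (B.corner o M) := (M.gr n).comap (B.corner o M).subtype

/-- The corner of a DG module over `R[θ]`, as a mixed complex. -/
def cornerObj : DGModule.{u, u, w} (mixedAlg k) :=
  DGModule.ofAct (fun r => by simp) (V := B.corner o M) (Algebra.ofId k _)
    (M.theta.restrict fun m hm => by
      rw [mem_corner] at hm ⊢
      rw [← theta_act, hm])
    (LinearMap.ext fun m => Subtype.ext (theta_theta _))
    (fun r => (Algebra.commutes r _).symm) (B.cornerGr o M)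
    -- The idempotent `E o o` acts in degree 0 and is a graded retraction of M onto the corner.
    (isInternal_of_retract M.internal (B.corner o M).subtype
      ((M.act (B.E o o)).codRestrict _ (B.act_E_mem_corner o M o))
      (fun y => Subtype.ext y.2) (fun n m hm => hm) fun n m hm => act_mem hm)
    (fun r i m hm => Submodule.smul_mem _ r hm)
    (fun i j h m hm => theta_mem h hm)
    (M.d.restrict fun m hm => by
      rw [mem_corner] at hm ⊢
      rw [← d_act, hm])
    (fun i m hm => M.d_mem hm)
    (fun m => Subtype.ext (M.d_d _))
    (fun r m => map_smul _ r m)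
    (fun m => Subtype.ext (by
      rw [map_zero, LinearMap.zero_apply, zero_sub]
      refine (d_theta m.1).trans ?_
      -- On the corner m = `E o o` m, and z · `E o o` = 0; so dθ + θd = z becomes the relation dθ +
      -- θd = 0 of a mixed complex.
      rw [← B.mem_corner o |>.1 m.2, ← act_mul_apply, B.z_mul_E, map_zero, LinearMap.zero_apply,
        zero_sub, B.mem_corner o |>.1 m.2]
      rfl))

/-- The map `E j o` from the corner to the module. -/
def incl (j : ι) : (B.cornerObj o M).carrier →ₗ[k] M.carrier :=
  M.act (B.E j o) ∘ₗ (B.corner o M).subtype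

/-- The map `E o j` from the module to the corner. -/
def proj (j : ι) : M.carrier →ₗ[k] (B.cornerObj o M).carrier :=
  (M.act (B.E o j)).codRestrict (B.corner o M) (B.act_E_mem_corner o M j)

variable {M N}

theorem incl_proj (i j : ι) (m : M.carrier) :
    B.incl o M i (B.proj o M j m) = M.act (B.E i j) m :=
  (act_mul_apply _ _ _).symm.trans (by rw [E_mul_E])

theorem proj_incl (j : ι) (x : (B.cornerObj o M).carrier) :
    B.proj o M j (B.incl o M j x) = x :=
  Subtype.ext ((act_mul_apply _ _ _).symm.trans (by rw [E_mul_E]; exact x.2))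

theorem proj_incl_of_ne {i j : ι} (h : i ≠ j) (x : (B.cornerObj o M).carrier) :
    B.proj o M i (B.incl o M j x) = 0 :=
  Subtype.ext ((act_mul_apply _ _ _).symm.trans (by rw [B.E_mul_E_of_ne h, map_zero]; rfl))

/-- The projection onto the matrix factor is the action of ∑ `E i i` = 1 - cz. It thus differs from
the identity by a multiple of z, which is null-homotopic. -/
theorem sum_incl_proj (m : M.carrier) :
    ∑ i, B.incl o M i (B.proj o M i m) = m - B.c • M.act z m := by
  have h : ∑ i, B.E i i = 1 - B.c • z := by rw [← B.one_sub_sum_E, sub_sub_cancel]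
  simp only [incl_proj]
  rw [← LinearMap.sum_apply, ← map_sum, h, map_sub, map_one, map_smul]
  rfl

theorem incl_mem {j : ι} {n : ℤ} {x : (B.cornerObj o M).carrier}
    (hx : x ∈ (B.cornerObj o M).gr n) : B.incl o M j x ∈ M.gr n :=
  act_mem hx

theorem proj_mem {j : ι} {n : ℤ} {m : M.carrier} (hm : m ∈ M.gr n) :
    B.proj o M j m ∈ (B.cornerObj o M).gr n :=
  act_mem (r := B.E o j) hm

theorem d_incl (j : ι) (x : (B.cornerObj o M).carrier) :
    M.d (B.incl o M j x) = B.incl o M j ((B.cornerObj o M).d x) :=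
  d_act _ _

theorem d_proj (j : ι) (m : M.carrier) :
    (B.cornerObj o M).d (B.proj o M j m) = B.proj o M j (M.d m) :=
  Subtype.ext (d_act _ _)

theorem cornerObj_theta (x : (B.cornerObj o M).carrier) :
    (B.corner o M).subtype ((B.cornerObj o M).theta x) = M.theta ((B.corner o M).subtype x) :=
  congrArg (B.corner o M).subtype (ofAct_theta x)

theorem theta_incl (j : ι) (x : (B.cornerObj o M).carrier) :
    M.theta (B.incl o M j x) = B.incl o M j ((B.cornerObj o M).theta x) := by
  exact (theta_act _ _).trans (congrArg _ (B.cornerObj_theta o x).symm)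

theorem theta_proj (j : ι) (m : M.carrier) :
    (B.cornerObj o M).theta (B.proj o M j m) = B.proj o M j (M.theta m) := by
  exact Subtype.ext ((B.cornerObj_theta o _).trans (theta_act _ _))

/-- R acts on the copies of the corner inside M by the matrices `rho r`, just as on column vectors.
-/
theorem act_incl (r : R) (j : ι) (x : (B.cornerObj o M).carrier) :
    M.act r (B.incl o M j x) = ∑ l, B.rho r l j • B.incl o M l x := by
  refine (act_mul_apply _ _ _).symm.trans ?_
  rw [B.mul_E, map_sum, LinearMap.sum_apply]
  refine Finset.sum_congr rfl fun l _ => ?_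
  rw [map_smul]
  rfl

theorem proj_act (r : R) (j : ι) (m : M.carrier) :
    B.proj o M j (M.act r m) = ∑ l, B.rho r j l • B.proj o M l m := by
  have h : M.act (B.E o j) (M.act r m) = ∑ l, B.rho r j l • M.act (B.E o l) m := by
    rw [← act_mul_apply, B.E_mul, map_sum, LinearMap.sum_apply]
    refine Finset.sum_congr rfl fun l _ => ?_
    rw [map_smul]
    rfl
  refine Subtype.ext (h.trans ?_)
  exact (map_sum (B.corner o M).subtype (fun l => B.rho r j l • B.proj o M l m) _).symm

end DG

end MatrixBlock

/-! ### The scalar action on mixed complexes; closed and exact morphisms. -/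

namespace DGModule

open DGAlgebra

/-- For mixed complexes the base ring is k itself, so the linearity condition in `mem_homs_iff` is
automatic and only the sign rule for θ is left to check. -/
theorem act_base {k : Type u} [Field k]
    {Y : DGModule.{u, u, w} (mixedAlg k)} (r : k) (y : Y.carrier) : Y.act r y = r • y := by
  have : Y.act r = algebraMap k (Module.End k Y.carrier) r := Y.act.commutes r
  rw [this]
  rfl

end DGModule

theorem DGCat.exact_sub_of_eq {k : Type u} [Field k] {C : DGCat.{u, u1, v1} k} {X Y : C.Obj} {n : ℤ}
    {a b : C.Hom X Y n} (h : a = b) : C.Exact (b - a) :=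
  ⟨0, by rw [h, map_zero, sub_self]⟩

namespace DGModule

variable {k : Type u} [Field k] {A : DGAlgebra.{u, v} k} {M N : DGModule.{u, v, w} A} {n : ℤ}

theorem closed_iff (f : (dgMod.{u, v, w} A).Hom M N n) :
    (dgMod A).Closed f ↔ ∀ m, N.d (f.1 m) = ((-1 : k) ^ n) • f.1 (M.d m) := by
  refine ⟨fun h m => ?_, fun h => Subtype.ext (LinearMap.ext fun m => ?_)⟩
  · exact sub_eq_zero.1 (LinearMap.congr_fun (congrArg Subtype.val h) m)
  · exact sub_eq_zero.2 (h m)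

theorem exact_of_eq {f : (dgMod.{u, v, w} A).Hom M N n} {h : M.carrier →ₗ[k] N.carrier}
    (hh : h ∈ homs M N (n - 1))
    (heq : ∀ m, N.d (h m) - ((-1 : k) ^ (n - 1)) • h (M.d m) = f.1 m) : (dgMod A).Exact f :=
  ⟨⟨h, hh⟩, Subtype.ext (LinearMap.ext heq)⟩

theorem exists_of_exact {f : (dgMod.{u, v, w} A).Hom M N n} (hf : (dgMod A).Exact f) :
    ∃ h ∈ homs M N (n - 1), ∀ m, N.d (h m) - ((-1 : k) ^ (n - 1)) • h (M.d m) = f.1 m := by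
  obtain ⟨h, hh⟩ := hf
  exact ⟨h.1, h.2, fun m => LinearMap.congr_fun (congrArg Subtype.val hh) m⟩

theorem exact_of_eq_zero {f : (dgMod.{u, v, w} A).Hom M N n} (hf : ∀ m, f.1 m = 0) :
    (dgMod A).Exact f :=
  exact_of_eq (zero_mem _) fun m => by rw [hf]; simp

end DGModule

namespace MatrixBlock

open DGAlgebra DGModule

variable {k : Type u} [Field k] {R : Type v} [Ring R] [Algebra k R] {z : R}
  {ι : Type} [Fintype ι] [DecidableEq ι] (B : MatrixBlock k R z ι)
  (hz : ∀ r : R, z * r = r * z)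

/-! ### Column vectors over a mixed complex. -/

section Power

variable (Y : DGModule.{u, u, w} (mixedAlg k))

open Matrix.Module in
/-- The action of `R` on a power of a vector space by matrices. -/
def powerAct (V : Type w) [AddCommGroup V] [Module k V] : R →ₐ[k] Module.End k (ι → V) :=
  (Algebra.lsmul k k (ι → V)).comp B.rho

theorem powerAct_apply (V : Type w) [AddCommGroup V] [Module k V] (r : R) (v : ι → V) (i : ι) :
    B.powerAct V r v i = ∑ j, B.rho r i j • v j := rfl

/-- The module of column vectors with entries in a mixed complex `Y`, as a DG module over
`R[θ]`. -/
def powerObj : DGModule.{u, v, w} (adjoinTheta k R z hz) :=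
  DGModule.ofAct hz (V := ι → Y.carrier) (B.powerAct Y.carrier) (Y.theta.compLeft ι)
    (LinearMap.ext fun v => funext fun i => theta_theta _)
    (fun r => LinearMap.ext fun v => funext fun i => by
      simp [powerAct_apply])
    (fun n => Submodule.pi (Set.univ : Set ι) fun _ => Y.gr n) (isInternal_pi Y.internal)
    (fun r i v hv j _ => sum_mem fun l _ => Submodule.smul_mem _ _ (hv l trivial))
    (fun i j h v hv l _ => theta_mem h (hv l trivial))
    (Y.d.compLeft ι)
    (fun i v hv l _ => Y.d_mem (hv l trivial))
    (fun v => funext fun i => Y.d_d _)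
    (fun r v => funext fun i => by simp [powerAct_apply])
    -- A module over R[θ] needs dθ + θd = z. Here the left side vanishes because Y is a mixed
    -- complex, and the right side because `rho z` = 0.
    (fun v => funext fun i => by
      have := d_theta (M := Y) (v i)
      rw [map_zero, LinearMap.zero_apply] at this
      simpa [B.rho_z, powerAct_apply] using this)

/-- The coordinates of a column vector. -/
def coord (j : ι) : (B.powerObj hz Y).carrier →ₗ[k] Y.carrier :=
  LinearMap.proj (R := k) (φ := fun _ : ι => Y.carrier) j

/-- The column vectors with a single nonzero coordinate. -/
def unitCol (j : ι) : Y.carrier →ₗ[k] (B.powerObj hz Y).carrier :=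
  LinearMap.single k (fun _ : ι => Y.carrier) j

variable {hz Y}

theorem power_ext {v v2 : (B.powerObj hz Y).carrier}
    (h : ∀ j, B.coord hz Y j v = B.coord hz Y j v2) : v = v2 :=
  funext h

theorem coord_unitCol (j : ι) (y : Y.carrier) : B.coord hz Y j (B.unitCol hz Y j y) = y :=
  Pi.single_eq_same (M := fun _ : ι => Y.carrier) j y

theorem sum_unitCol_coord (v : (B.powerObj hz Y).carrier) :
    ∑ j, B.unitCol hz Y j (B.coord hz Y j v) = v :=
  Finset.univ_sum_single (M := fun _ : ι => Y.carrier) v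

theorem mem_power {n : ℤ} {v : (B.powerObj hz Y).carrier} :
    v ∈ (B.powerObj hz Y).gr n ↔ ∀ j, B.coord hz Y j v ∈ Y.gr n :=
  ⟨fun h j => h j trivial, fun h j _ => h j⟩

theorem unitCol_mem {n : ℤ} {y : Y.carrier} (j : ι) (hy : y ∈ Y.gr n) :
    B.unitCol hz Y j y ∈ (B.powerObj hz Y).gr n := by
  refine B.mem_power.2 fun l => ?_
  by_cases h : l = j
  · subst h; rwa [coord_unitCol]
  · have : B.coord hz Y l (B.unitCol hz Y j y) = 0 := Pi.single_eq_of_ne h _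
    rw [this]
    exact zero_mem _

theorem coord_d (j : ι) (v : (B.powerObj hz Y).carrier) :
    B.coord hz Y j ((B.powerObj hz Y).d v) = Y.d (B.coord hz Y j v) := rfl

theorem d_unitCol (j : ι) (y : Y.carrier) :
    (B.powerObj hz Y).d (B.unitCol hz Y j y) = B.unitCol hz Y j (Y.d y) :=
  funext fun l => Pi.apply_single (fun (_ : ι) => Y.d) (fun _ => map_zero _) j y l

theorem coord_theta (j : ι) (v : (B.powerObj hz Y).carrier) :
    B.coord hz Y j ((B.powerObj hz Y).theta v) = Y.theta (B.coord hz Y j v) :=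
  congrArg (B.coord hz Y j) (ofAct_theta (hz := hz) v)

theorem theta_unitCol (j : ι) (y : Y.carrier) :
    (B.powerObj hz Y).theta (B.unitCol hz Y j y) = B.unitCol hz Y j (Y.theta y) :=
  (ofAct_theta (hz := hz) _).trans
    (funext fun l => Pi.apply_single (fun (_ : ι) => Y.theta) (fun _ => map_zero _) j y l)

theorem coord_act (r : R) (j : ι) (v : (B.powerObj hz Y).carrier) :
    B.coord hz Y j ((B.powerObj hz Y).act r v) = ∑ l, B.rho r j l • B.coord hz Y l v :=
  congrArg (B.coord hz Y j) (ofAct_act (hz := hz) r v)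

theorem act_E_power (i j : ι) (v : (B.powerObj hz Y).carrier) :
    (B.powerObj hz Y).act (B.E i j) v = B.unitCol hz Y i (B.coord hz Y j v) := by
  refine B.power_ext fun l => ?_
  rw [coord_act, B.rho_E]
  by_cases h : l = i
  · subst h
    rw [coord_unitCol]
    simp [Matrix.single_apply]
  · have h2 : B.coord hz Y l (B.unitCol hz Y i (B.coord hz Y j v)) = 0 := Pi.single_eq_of_ne h _
    rw [h2]
    simp [Ne.symm h]

end Power

/-! ### The corner functor is a quasi-equivalence. -/

section Functor

variable {hz} (o : ι) {M N : DGModule.{u, v, w} (adjoinTheta k R z hz)}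
  {Y : DGModule.{u, u, w} (mixedAlg k)} {n : ℤ}

variable (M N) in
/-- The action of the corner functor on morphisms. -/
def cornerMap : (M.carrier →ₗ[k] N.carrier) →ₗ[k]
    ((B.cornerObj o M).carrier →ₗ[k] (B.cornerObj o N).carrier) where
  toFun f := B.proj o N o ∘ₗ f ∘ₗ B.incl o M o
  map_add' _ _ := LinearMap.ext fun _ => map_add (B.proj o N o) _ _
  map_smul' _ _ := LinearMap.ext fun _ => map_smul (B.proj o N o) _ _

theorem cornerMap_apply (f : M.carrier →ₗ[k] N.carrier) (x : (B.cornerObj o M).carrier) :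
    B.cornerMap o M N f x = B.proj o N o (f (B.incl o M o x)) := rfl

/-- A morphism of any degree commutes with the matrix units without sign, as they lie in degree 0.
On the matrix factor it is therefore its corner map applied to each copy of the corner. -/
theorem hom_incl {f : M.carrier →ₗ[k] N.carrier} (hf : f ∈ homs M N n) (j : ι)
    (x : (B.cornerObj o M).carrier) :
    f (B.incl o M j x) = B.incl o N j (B.cornerMap o M N f x) := by
  rw [cornerMap_apply, incl_proj, ← (mem_homs_iff.1 hf).2.1, ← incl_proj B o, proj_incl]

theorem proj_hom {f : M.carrier →ₗ[k] N.carrier} (hf : f ∈ homs M N n) (j : ι) (m : M.carrier) :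
    B.proj o N j (f m) = B.cornerMap o M N f (B.proj o M j m) := by
  rw [cornerMap_apply, incl_proj, (mem_homs_iff.1 hf).2.1, ← incl_proj B o, proj_incl]

theorem cornerMap_mem {f : M.carrier →ₗ[k] N.carrier} (hf : f ∈ homs M N n) :
    B.cornerMap o M N f ∈ homs (B.cornerObj o M) (B.cornerObj o N) n := by
  rw [mem_homs_iff] at hf ⊢
  refine ⟨fun i x hx => B.proj_mem o (hf.1 _ _ (B.incl_mem o hx)), fun r x => ?_, fun x => ?_⟩
  · rw [act_base, act_base, map_smul]
  · rw [cornerMap_apply, cornerMap_apply, ← theta_incl, hf.2.2, map_smul, theta_proj]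

theorem cornerMap_dLin (f : M.carrier →ₗ[k] N.carrier) (n : ℤ) :
    B.cornerMap o M N (dLin M N n f) =
      dLin (B.cornerObj o M) (B.cornerObj o N) n (B.cornerMap o M N f) := by
  refine LinearMap.ext fun x => ?_
  rw [cornerMap_apply, dLin_apply, dLin_apply, cornerMap_apply, cornerMap_apply, map_sub,
    map_smul, d_proj, d_incl]

variable (M N) in
/-- The extension of a map between corners. -/
def extend (b : (B.cornerObj o M).carrier →ₗ[k] (B.cornerObj o N).carrier) :
    M.carrier →ₗ[k] N.carrier :=
  ∑ j, B.incl o N j ∘ₗ b ∘ₗ B.proj o M j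

theorem extend_apply (b : (B.cornerObj o M).carrier →ₗ[k] (B.cornerObj o N).carrier)
    (m : M.carrier) : B.extend o M N b m = ∑ j, B.incl o N j (b (B.proj o M j m)) := by
  simp [extend]

/-- Linearity over R is an exchange of two summations: `proj_act` and `act_incl` expand through the
same matrix entries, and b commutes with scalars. -/
theorem extend_mem {b : (B.cornerObj o M).carrier →ₗ[k] (B.cornerObj o N).carrier}
    (hb : b ∈ homs (B.cornerObj o M) (B.cornerObj o N) n) : B.extend o M N b ∈ homs M N n := by
  rw [mem_homs_iff] at hb ⊢
  refine ⟨fun i m hm => ?_, fun r m => ?_, fun m => ?_⟩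
  · rw [extend_apply]
    exact sum_mem fun j _ => B.incl_mem o (hb.1 _ _ (B.proj_mem o hm))
  · simp only [extend_apply, map_sum, proj_act, act_incl, map_smul]
    exact Finset.sum_comm
  · simp only [extend_apply, map_sum, ← theta_proj, theta_incl, hb.2.2, map_smul, Finset.smul_sum]

theorem d_extend (b : (B.cornerObj o M).carrier →ₗ[k] (B.cornerObj o N).carrier) (n : ℤ)
    (m : M.carrier) : N.d (B.extend o M N b m) - ((-1 : k) ^ n) • B.extend o M N b (M.d m) =
      ∑ j, B.incl o N j (dLin (B.cornerObj o M) (B.cornerObj o N) n b (B.proj o M j m)) := by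
  simp only [extend_apply, map_sum, d_incl, dLin_apply, map_sub, map_smul, Finset.sum_sub_distrib,
    Finset.smul_sum, d_proj]

theorem cornerMap_extend (b : (B.cornerObj o M).carrier →ₗ[k] (B.cornerObj o N).carrier) :
    B.cornerMap o M N (B.extend o M N b) = b := by
  refine LinearMap.ext fun x => ?_
  rw [cornerMap_apply, extend_apply, map_sum, Finset.sum_eq_single o]
  · rw [proj_incl, proj_incl]
  · intro j _ hj
    rw [B.proj_incl_of_ne o (Ne.symm hj)]
  · exact fun h => absurd (Finset.mem_univ _) h

variable (M N n) in
/-- The action of the corner functor on morphisms of degree `n`. -/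
def cornerHom : homs M N n →ₗ[k] homs (B.cornerObj o M) (B.cornerObj o N) n :=
  (B.cornerMap o M N).restrict fun _ hf => B.cornerMap_mem o hf

variable (hz) in
/-- The DG functor from DG modules over `R[θ]` to mixed complexes that cuts out the corner. -/
def cornerFunctor : DGFunctor (dgMod.{u, v, w} (adjoinTheta k R z hz))
    (dgMod.{u, u, w} (mixedAlg k)) where
  obj M := B.cornerObj o M
  map {M N n} := B.cornerHom o M N n
  map_d {M N n m} h f := Subtype.ext (B.cornerMap_dLin o f.1 n)
  map_id M := Subtype.ext (LinearMap.ext fun x => B.proj_incl o o x)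
  map_comp {M N L i j n} h b a := Subtype.ext (LinearMap.ext fun x => by
    -- The corner map of the composite would see the inner value only through the corner; nothing is
    -- lost because a maps the corner of M into that of N.
    refine (congrArg (fun t => B.proj o L o (b.1 t)) (B.hom_incl o a.2 o x)).trans ?_
    rfl)

/-- The action of `cθ` gives a homotopy from `1` to the projection to the block. -/
theorem d_smul_theta (m : M.carrier) : M.d (B.c • M.theta m) =
    m - ∑ i, B.incl o M i (B.proj o M i m) - B.c • M.theta (M.d m) := by
  rw [sum_incl_proj, sub_sub_cancel, map_smul, d_theta, smul_sub]

/-- The primitive of f is the extension of b plus cθf. The differential of the first summand is the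
component of f in the matrix factor. Since f is closed and cθ contracts the complementary factor,
the differential of the second is the remaining component of f. -/
theorem exists_homotopy {f : M.carrier →ₗ[k] N.carrier} (hf : f ∈ homs M N n)
    (hd : ∀ m, N.d (f m) = ((-1 : k) ^ n) • f (M.d m))
    {b : (B.cornerObj o M).carrier →ₗ[k] (B.cornerObj o N).carrier}
    (hb : b ∈ homs (B.cornerObj o M) (B.cornerObj o N) (n - 1))
    (hbf : ∀ x, dLin (B.cornerObj o M) (B.cornerObj o N) (n - 1) b x = B.cornerMap o M N f x) :
    ∃ h ∈ homs M N (n - 1), ∀ m, N.d (h m) - ((-1 : k) ^ (n - 1)) • h (M.d m) = f m := by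
  have hfm := mem_homs_iff.1 hf
  have hθ : B.c • N.theta ∘ₗ f ∈ homs M N (n - 1) := by
    rw [mem_homs_iff]
    refine ⟨fun i m hm => ?_, fun r m => ?_, fun m => ?_⟩
    · exact Submodule.smul_mem _ _ (theta_mem (by ring) (hfm.1 i m hm))
    · simp only [LinearMap.smul_apply, LinearMap.comp_apply, hfm.2.1, theta_act, map_smul]
    -- Both sides of the sign rule for θ vanish because θ² = 0, so the sign does not matter.
    · simp only [LinearMap.smul_apply, LinearMap.comp_apply, hfm.2.2, theta_theta, map_smul,
        smul_zero]
  refine ⟨_, add_mem (B.extend_mem o hb) hθ, fun m => ?_⟩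
  have h1 : N.d (B.extend o M N b m) - ((-1 : k) ^ (n - 1)) • B.extend o M N b (M.d m) =
      ∑ j, B.incl o N j (B.proj o N j (f m)) := by
    rw [d_extend]
    refine Finset.sum_congr rfl fun j _ => ?_
    rw [hbf, B.proj_hom o hf]
  have h2 := B.d_smul_theta o (f m)
  rw [hd m, map_smul] at h2
  -- The opposite signs in degrees n and n - 1 make the two terms containing θf(dm) cancel.
  have h3 : (-1 : k) ^ (n - 1) = -(-1) ^ n := by
    rw [zpow_sub_one₀ (by simp)]
    simp
  have h4 : N.d (B.c • N.theta (f m)) - ((-1 : k) ^ (n - 1)) • B.c • N.theta (f (M.d m)) =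
      f m - ∑ j, B.incl o N j (B.proj o N j (f m)) := by
    rw [map_smul, h2, h3, map_smul]
    module
  rw [LinearMap.add_apply, LinearMap.add_apply, map_add, smul_add, add_sub_add_comm, h1]
  exact (congrArg (_ + ·) h4).trans (add_sub_cancel _ _)

theorem exact_of_exact_cornerHom (f : (dgMod.{u, v, w} (adjoinTheta k R z hz)).Hom M N n)
    (hf : (dgMod _).Closed f) (h : (dgMod.{u, u, w} (mixedAlg k)).Exact (X := B.cornerObj o M)
      (Y := B.cornerObj o N) (B.cornerHom o M N n f)) : (dgMod _).Exact f := by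
  obtain ⟨b, hb, hbf⟩ := exists_of_exact h
  obtain ⟨h, hh, hhf⟩ := B.exists_homotopy o f.2 ((closed_iff f).1 hf) hb hbf
  exact exact_of_eq hh hhf

/-- The map from `Y` to the corner of the column vectors. -/
def toCornerPower : Y.carrier →ₗ[k] (B.cornerObj o (B.powerObj hz Y)).carrier :=
  B.proj o _ o ∘ₗ B.unitCol hz Y o

/-- The map from the corner of the column vectors to `Y`. -/
def ofCornerPower : (B.cornerObj o (B.powerObj hz Y)).carrier →ₗ[k] Y.carrier :=
  B.coord hz Y o ∘ₗ B.incl o _ o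

theorem toCornerPower_mem :
    B.toCornerPower (hz := hz) o ∈ homs Y (B.cornerObj o (B.powerObj hz Y)) 0 := by
  rw [mem_homs_iff]
  refine ⟨fun i y hy => ?_, fun r y => by rw [act_base, act_base, map_smul], fun y => ?_⟩
  · rw [add_zero]
    exact B.proj_mem o (B.unitCol_mem o hy)
  · rw [zpow_zero, one_smul, toCornerPower, LinearMap.comp_apply, LinearMap.comp_apply, theta_proj,
      theta_unitCol]

theorem ofCornerPower_mem :
    B.ofCornerPower (hz := hz) o ∈ homs (B.cornerObj o (B.powerObj hz Y)) Y 0 := by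
  rw [mem_homs_iff]
  refine ⟨fun i y hy => ?_, fun r y => by rw [act_base, act_base, map_smul], fun y => ?_⟩
  · rw [add_zero]
    exact B.mem_power.1 (B.incl_mem o hy) o
  · rw [zpow_zero, one_smul, ofCornerPower, LinearMap.comp_apply, LinearMap.comp_apply,
      ← theta_incl, coord_theta]

theorem ofCornerPower_toCornerPower (y : Y.carrier) :
    B.ofCornerPower (hz := hz) o (B.toCornerPower o y) = y := by
  change B.coord hz Y o (B.incl o _ o (B.proj o _ o (B.unitCol hz Y o y))) = y
  rw [incl_proj, act_E_power, coord_unitCol, coord_unitCol]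

theorem toCornerPower_ofCornerPower (x : (B.cornerObj o (B.powerObj hz Y)).carrier) :
    B.toCornerPower o (B.ofCornerPower o x) = x := by
  change B.proj o _ o (B.unitCol hz Y o (B.coord hz Y o (B.incl o _ o x))) = x
  rw [← act_E_power, ← incl_proj B o, proj_incl, proj_incl]

/-- The two maps are mutually inverse closed morphisms, so the required homotopies are zero. -/
theorem homotopyEquivalent_corner_power :
    (dgMod.{u, u, w} (mixedAlg k)).HomotopyEquivalent (B.cornerObj o (B.powerObj hz Y)) Y := by
  refine ⟨⟨_, B.ofCornerPower_mem o⟩, ⟨_, B.toCornerPower_mem o⟩, (closed_iff _).2 fun m => ?_,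
    (closed_iff _).2 fun m => ?_, exact_of_eq_zero fun m => ?_, exact_of_eq_zero fun m => ?_⟩
  · rw [zpow_zero, one_smul]
    change Y.d (B.coord hz Y o (B.incl o _ o m)) = B.coord hz Y o (B.incl o _ o _)
    rw [← d_incl, coord_d]
  · rw [zpow_zero, one_smul]
    change (B.cornerObj o _).d (B.proj o _ o (B.unitCol hz Y o m)) =
      B.proj o _ o (B.unitCol hz Y o _)
    rw [d_proj, d_unitCol]
  · exact sub_eq_zero.2 (B.toCornerPower_ofCornerPower o m)
  · exact sub_eq_zero.2 (B.ofCornerPower_toCornerPower o m)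

/-- `extend` is a section of the corner functor on morphisms and commutes with differentials. Lifts
therefore exist on the nose, not merely up to exact morphisms. -/
theorem exists_closed_cornerHom
    (b : (dgMod.{u, u, w} (mixedAlg k)).Hom (B.cornerObj o M) (B.cornerObj o N) n)
    (hb : (dgMod _).Closed b) : ∃ a : (dgMod.{u, v, w} (adjoinTheta k R z hz)).Hom M N n,
      (dgMod _).Closed a ∧ B.cornerHom o M N n a = b := by
  refine ⟨⟨_, B.extend_mem o b.2⟩, (closed_iff _).2 fun m => sub_eq_zero.1 ?_,
    Subtype.ext (B.cornerMap_extend o b.1)⟩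
  rw [d_extend]
  have h : dLin (B.cornerObj o M) (B.cornerObj o N) n b.1 = 0 := congrArg Subtype.val hb
  rw [h]
  simp

theorem cornerFunctor_isQuasiEquivalence :
    (B.cornerFunctor.{u, v, w} hz o).IsQuasiEquivalence where
  surj _ _ _ b hb :=
    let ⟨a, ha, hab⟩ := B.exists_closed_cornerHom o b hb
    ⟨a, ha, DGCat.exact_sub_of_eq hab⟩
  inj _ _ _ a ha h := B.exact_of_exact_cornerHom o a ha h
  essSurj Y := ⟨B.powerObj hz Y, B.homotopyEquivalent_corner_power o⟩

/-- Up to the contractible complementary part, a module is a finite sum of copies of its corner and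
f is the corresponding sum of copies of its corner map. -/
theorem quasiIso_iff_cornerHom (f : (dgMod.{u, v, w} (adjoinTheta k R z hz)).Hom M N 0)
    (hf : (dgMod _).Closed f) : QuasiIso f ↔ QuasiIso (A := mixedAlg k) (M := B.cornerObj o M)
      (N := B.cornerObj o N) (B.cornerHom o M N 0 f) := by
  have hmap (x : (B.cornerObj o M).carrier) :
      (B.cornerHom o M N 0 f).1 x = B.cornerMap o M N f.1 x := rfl
  have hfd (m : M.carrier) : N.d (f.1 m) = f.1 (M.d m) := by
    have := (closed_iff f).1 hf m
    rwa [zpow_zero, one_smul] at this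
  refine ⟨fun h => ⟨fun y hy => ?_, fun x hx => ?_⟩, fun h => ⟨fun y hy => ?_, fun x hx => ?_⟩⟩
  · obtain ⟨x, hx, l, hl⟩ := h.1 (B.incl o N o y) (by rw [d_incl, hy, map_zero])
    refine ⟨B.proj o M o x, by rw [d_proj, hx, map_zero], B.proj o N o l, ?_⟩
    rw [d_proj, hl, map_sub, proj_incl, B.proj_hom o f.2]
    rfl
  · rintro ⟨l, hl⟩
    obtain ⟨l2, hl2⟩ := h.2 (B.incl o M o x) (by rw [d_incl, hx, map_zero])
      ⟨B.incl o N o l, by rw [d_incl, hl, B.hom_incl o f.2]; rfl⟩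
    exact ⟨B.proj o M o l2, by rw [d_proj, hl2, proj_incl]⟩
  -- Each corner coordinate of the cycle y is lifted separately; what is left of y outside the
  -- matrix factor is the boundary of cθy. Injectivity below is treated in the same way.
  · choose x hx l hl using fun j => h.1 (B.proj o N j y) (by rw [d_proj, hy, map_zero])
    refine ⟨∑ j, B.incl o M j (x j), by simp only [map_sum, d_incl, hx, map_zero,
      Finset.sum_const_zero], ∑ j, B.incl o N j (l j) + B.c • N.theta y, ?_⟩
    rw [map_add, B.d_smul_theta o, hy, map_zero, smul_zero]
    simp only [map_sum, d_incl, hl, map_sub, Finset.sum_sub_distrib, hmap, B.hom_incl o f.2]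
    abel
  · rintro ⟨l, hl⟩
    choose l2 hl2 using fun j => h.2 (B.proj o M j x) (by rw [d_proj, hx, map_zero])
      ⟨B.proj o N j l, by rw [d_proj, hl, B.proj_hom o f.2]; rfl⟩
    refine ⟨∑ j, B.incl o M j (l2 j) + B.c • M.theta x, ?_⟩
    rw [map_add, B.d_smul_theta o, hx, map_zero, smul_zero]
    simp only [map_sum, d_incl, hl2]
    abel

/-! ### Acyclic and h-projective DG modules. -/

theorem acyclic_power (hY : Y.Acyclic) : (B.powerObj hz Y).Acyclic := by
  intro v hv
  choose l hl using fun j => hY (B.coord hz Y j v) (by rw [← coord_d, hv, map_zero])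
  exact ⟨l, funext hl⟩

theorem acyclic_corner (hM : M.Acyclic) : (B.cornerObj o M).Acyclic := by
  intro x hx
  obtain ⟨l, hl⟩ := hM (B.incl o M o x) (by rw [d_incl, hx, map_zero])
  exact ⟨B.proj o M o l, by rw [d_proj, hl, proj_incl]⟩

/-- The corner functor is left adjoint to the functor of column vectors. -/
def toPower (f : (B.cornerObj o M).carrier →ₗ[k] Y.carrier) :
    M.carrier →ₗ[k] (B.powerObj hz Y).carrier :=
  LinearMap.pi (φ := fun _ : ι => Y.carrier) fun j => f ∘ₗ B.proj o M j

theorem coord_toPower (f : (B.cornerObj o M).carrier →ₗ[k] Y.carrier) (j : ι) (m : M.carrier) :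
    B.coord hz Y j (B.toPower o f m) = f (B.proj o M j m) := rfl

theorem toPower_mem {f : (B.cornerObj o M).carrier →ₗ[k] Y.carrier}
    (hf : f ∈ homs (B.cornerObj o M) Y n) : B.toPower o f ∈ homs M (B.powerObj hz Y) n := by
  rw [mem_homs_iff] at hf ⊢
  refine ⟨fun i m hm => B.mem_power.2 fun j => hf.1 _ _ (B.proj_mem o hm),
    fun r m => B.power_ext fun j => ?_, fun m => B.power_ext fun j => ?_⟩
  · simp only [coord_toPower, coord_act, proj_act, map_sum, map_smul]
  · rw [coord_toPower, map_smul, coord_theta, coord_toPower, ← theta_proj, hf.2.2]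

/-- A left adjoint preserves h-projectivity when its right adjoint preserves acyclicity; here the
right adjoint is Y ↦ column vectors over Y. -/
theorem hProjective_corner (hM : HProjective M) : HProjective (B.cornerObj o M) := by
  intro Y hY n f hf
  rw [closed_iff] at hf
  obtain ⟨h, hh, hhf⟩ := exists_of_exact (hM (B.powerObj hz Y) (B.acyclic_power hY) n
    ⟨_, B.toPower_mem o f.2⟩ ((closed_iff _).2 fun m => B.power_ext fun j => by
      rw [coord_d, map_smul, coord_toPower, coord_toPower, hf, d_proj]))
  rw [mem_homs_iff] at hh
  -- The primitive found for the adjoint morphism is transported back: the coordinate at `o`,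
  -- restricted to the copy of the corner at `o`, recovers f from `toPower`.
  refine exact_of_eq (h := B.coord hz Y o ∘ₗ h ∘ₗ B.incl o M o) (mem_homs_iff.2
    ⟨fun i x hx => ?_, fun r x => by rw [act_base, act_base, map_smul], fun x => ?_⟩) fun x => ?_
  · exact B.mem_power.1 (hh.1 _ _ (B.incl_mem o hx)) o
  · simp only [LinearMap.comp_apply]
    rw [← theta_incl, hh.2.2, map_smul, coord_theta]
  · simp only [LinearMap.comp_apply]
    rw [← d_incl, ← coord_d, ← map_smul, ← map_sub, hhf, coord_toPower, proj_incl]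

/-- The functor of column vectors is left adjoint to the corner functor. -/
def ofPower (f : Y.carrier →ₗ[k] (B.cornerObj o M).carrier) :
    (B.powerObj hz Y).carrier →ₗ[k] M.carrier :=
  ∑ j, B.incl o M j ∘ₗ f ∘ₗ B.coord hz Y j

theorem ofPower_apply (f : Y.carrier →ₗ[k] (B.cornerObj o M).carrier)
    (v : (B.powerObj hz Y).carrier) :
    B.ofPower o f v = ∑ j, B.incl o M j (f (B.coord hz Y j v)) := by
  simp [ofPower]

theorem ofPower_mem {f : Y.carrier →ₗ[k] (B.cornerObj o M).carrier}
    (hf : f ∈ homs Y (B.cornerObj o M) n) : B.ofPower o f ∈ homs (B.powerObj hz Y) M n := by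
  rw [mem_homs_iff] at hf ⊢
  refine ⟨fun i v hv => ?_, fun r v => ?_, fun v => ?_⟩
  · rw [ofPower_apply]
    exact sum_mem fun j _ => B.incl_mem o (hf.1 _ _ (B.mem_power.1 hv j))
  · simp only [ofPower_apply, map_sum, coord_act, act_incl, map_smul]
    exact Finset.sum_comm
  · simp only [ofPower_apply, map_sum, coord_theta, theta_incl, hf.2.2, map_smul, Finset.smul_sum]

/-- The same argument for the other adjunction: column vectors are left adjoint to the corner, and
the corner of an acyclic module is acyclic. -/
theorem hProjective_power (o : ι) (hY : HProjective Y) : HProjective (B.powerObj hz Y) := by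
  intro N hN n f hf
  rw [closed_iff] at hf
  have hfm := mem_homs_iff.1 f.2
  have hg : B.proj o N o ∘ₗ f.1 ∘ₗ B.unitCol hz Y o ∈ homs Y (B.cornerObj o N) n := by
    refine mem_homs_iff.2 ⟨fun i y hy => ?_, fun r y => by rw [act_base, act_base, map_smul],
      fun y => ?_⟩
    · exact B.proj_mem o (hfm.1 _ _ (B.unitCol_mem o hy))
    · simp only [LinearMap.comp_apply]
      rw [← theta_unitCol, hfm.2.2, map_smul, theta_proj]
  obtain ⟨h, hh, hhf⟩ := exists_of_exact (hY (B.cornerObj o N) (B.acyclic_corner o hN) n ⟨_, hg⟩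
    ((closed_iff _).2 fun y => by
      simp only [LinearMap.comp_apply]
      rw [d_proj, hf, map_smul, d_unitCol]))
  refine exact_of_eq (B.ofPower_mem o hh) fun v => ?_
  -- f commutes with `E j o`, which moves the entry in position `o` to position `j`; so f is
  -- determined by its values on columns supported at `o`.
  have h1 (j : ι) : B.incl o N j (B.proj o N o (f.1 (B.unitCol hz Y o (B.coord hz Y j v)))) =
      f.1 (B.unitCol hz Y j (B.coord hz Y j v)) := by
    rw [incl_proj, ← hfm.2.1, act_E_power, coord_unitCol]
  have h2 (y : Y.carrier) : (B.cornerObj o N).d (h y) - ((-1 : k) ^ (n - 1)) • h (Y.d y) =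
      B.proj o N o (f.1 (B.unitCol hz Y o y)) := hhf y
  simp only [ofPower_apply, map_sum, d_incl, coord_d, Finset.smul_sum, ← map_smul]
  rw [← Finset.sum_sub_distrib]
  simp only [← map_sub]
  simp only [map_smul, h2, h1]
  rw [← map_sum, sum_unitCol_coord]

/-- Morphism complexes are unchanged in a full subcategory. Only essential surjectivity needs more:
the preimage of an h-projective Y can be taken to be its column vectors, which are h-projective. -/
theorem cornerFunctor_restrict_isQuasiEquivalence :
    ((B.cornerFunctor.{u, v, w} hz o).restrict HProjective HProjective
      fun _ h => B.hProjective_corner o h).IsQuasiEquivalence where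
  surj _ _ _ b hb :=
    let ⟨a, ha, hab⟩ := B.exists_closed_cornerHom o b hb
    ⟨a, ha, DGCat.exact_sub_of_eq hab⟩
  inj _ _ _ a ha h := B.exact_of_exact_cornerHom o a ha h
  essSurj Y := ⟨⟨B.powerObj hz Y.1, B.hProjective_power o Y.2⟩,
    B.homotopyEquivalent_corner_power o⟩

end Functor

end MatrixBlock

/-! ### The quotient R/z, Morita equivalence and diagonalizability. -/

theorem quotientBy_mk_eq_zero {R : Type v} [Ring R] {a r : R} :
    ((r : R) : quotientBy a) = 0 ↔ r ∈ TwoSidedIdeal.span {a} := by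
  rw [TwoSidedIdeal.mem_iff]
  exact RingCon.eq _

theorem span_singleton_le_ker {R : Type v} [Ring R] {S : Type*} [Ring S] {a : R} (f : R →+* S)
    (ha : f a = 0) : (TwoSidedIdeal.span {a}).ringCon ≤ RingCon.ker f := by
  have h : TwoSidedIdeal.span {a} ≤ TwoSidedIdeal.ker f := by
    rw [TwoSidedIdeal.span_le, Set.singleton_subset_iff]
    exact (TwoSidedIdeal.mem_ker f).2 ha
  exact TwoSidedIdeal.ringCon_le_iff.1 h

/-- The universal property of `quotientBy`. -/
def quotientByLift {k : Type u} [Field k] {R : Type v} [Ring R] [Algebra k R] {S : Type*} [Ring S]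
    [Algebra k S] {a : R} (f : R →ₐ[k] S) (ha : f a = 0) : quotientBy a →ₐ[k] S :=
  RingCon.liftₐ _ f (span_singleton_le_ker f.toRingHom ha)

namespace MatrixBlock

variable {k : Type u} [Field k] {R : Type v} [Ring R] [Algebra k R] {z : R}
  {ι : Type} [Fintype ι] [DecidableEq ι] (B : MatrixBlock k R z ι)

/-- Multiply 1 - ∑ `E i i` = cz by z, which annihilates the matrix units. Thus z is a root of a
polynomial cX² - X. -/
theorem c_smul_z_mul_z : B.c • (z * z) = z := by
  rw [← mul_smul_comm, ← B.one_sub_sum_E, mul_sub, mul_one, Finset.mul_sum]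
  simp [B.z_mul_E]

/-- By cz² = z, the decomposition r = (r - czr) + czr has its summands in the eigenspaces for 0 and
c⁻¹. -/
theorem iSup_eigenspace_mulLeft (B : MatrixBlock k R z ι) :
    ⨆ μ : k, Module.End.eigenspace (LinearMap.mulLeft k z) μ = ⊤ := by
  refine eq_top_iff.2 fun r _ => ?_
  have h (r : R) : B.c • (z * (z * r)) = z * r := by
    rw [← mul_assoc, ← smul_mul_assoc, B.c_smul_z_mul_z]
  have h1 : r - B.c • (z * r) ∈ Module.End.eigenspace (LinearMap.mulLeft k z) 0 := by
    rw [Module.End.mem_eigenspace_iff, LinearMap.mulLeft_apply, mul_sub, mul_smul_comm, h, sub_self,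
      zero_smul]
  have h2 : B.c • (z * r) ∈ Module.End.eigenspace (LinearMap.mulLeft k z) B.c⁻¹ := by
    rw [Module.End.mem_eigenspace_iff, LinearMap.mulLeft_apply, mul_smul_comm, h]
    -- If c = 0, then cz² = z forces zr = 0, and the convention for the inverse of 0 is harmless.
    by_cases hc : B.c = 0
    · have := h r
      rw [hc, zero_smul] at this
      rw [← this, smul_zero, smul_zero]
    · rw [smul_smul, inv_mul_cancel₀ hc, one_smul]
  rw [← sub_add_cancel r (B.c • (z * r))]
  exact add_mem (Submodule.mem_iSup_of_mem _ h1) (Submodule.mem_iSup_of_mem _ h2)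

/-- Multiply 1 - ∑ `E i i` = cz by r on the right: the terms `E i i` · r vanish. Hence the kernel of
`rho` lies in the ideal generated by z. -/
theorem eq_of_rho_eq_zero {r : R} (hr : B.rho r = 0) : r = B.c • (z * r) := by
  have h := congrArg (· * r) B.one_sub_sum_E
  simpa [sub_mul, Finset.sum_mul, B.E_mul, hr] using h

theorem rho_surjective : Function.Surjective B.rho := by
  intro A
  refine ⟨∑ i, ∑ j, A i j • B.E i j, ?_⟩
  conv_rhs => rw [Matrix.matrix_eq_sum_single A]
  simp [B.rho_E, Matrix.smul_single]

/-- The quotient of `R` by `z` is the matrix algebra. -/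
def quotientEquiv : quotientBy z ≃ₐ[k] Matrix ι ι k :=
  AlgEquiv.ofBijective (quotientByLift B.rho B.rho_z) ⟨by
    refine (injective_iff_map_eq_zero _).2 fun r => ?_
    induction r using Quotient.inductionOn with
    | _ r =>
      intro hr
      refine quotientBy_mk_eq_zero.2 ?_
      rw [B.eq_of_rho_eq_zero (r := r) hr, ← mul_smul_comm]
      exact TwoSidedIdeal.mul_mem_right _ _ _ (TwoSidedIdeal.subset_span rfl),
    fun A => by
      obtain ⟨r, hr⟩ := B.rho_surjective A
      exact ⟨(r : quotientBy z), hr⟩⟩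

open CategoryTheory in
/-- Morita equivalence between `R / z` and `k`. -/
def moduleCatEquiv (o : ι) : ModuleCat.{w} (quotientBy z) ≌ ModuleCat.{w} k :=
  (ModuleCat.restrictScalarsEquivalenceOfRingEquiv
    B.quotientEquiv.symm.toRingEquiv).trans (ModuleCat.matrixEquivalence.{u, 0, w} k o).symm

/-- On the matrix side a scalar acts through the scalar matrix, on the side of R/z through the
structure map; the algebra isomorphism `quotientEquiv` identifies the two. -/
theorem moduleCatEquiv_functor_linear (o : ι) :
    CategoryTheory.Functor.Linear k (B.moduleCatEquiv.{u, v, w} o).functor where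
  map_smul {X Y} f r := by
    refine ModuleCat.hom_ext (LinearMap.ext fun x => Subtype.ext ?_)
    have h : B.quotientEquiv.symm (Matrix.scalar ι r) = algebraMap k (quotientBy z) r :=
      B.quotientEquiv.symm.commutes r
    change algebraMap k (quotientBy z) r • f.hom x.1 =
      B.quotientEquiv.symm (Matrix.scalar ι r) • f.hom x.1
    rw [h]

end MatrixBlock

/-! ### The product of the twisted double of Sweedler's algebra in coordinates. -/

namespace TwistedDouble

open Sweedler

variable {k : Type u} [Field k]

theorem g_mul_x_mul_g : g k * x k * g k = -x k := by
  rw [g_mul_x, neg_mul, mul_assoc, g_mul_g, mul_one]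

theorem antipode_g : antipode k (g k) = g k := antipodeMap_g k

theorem antipode_x : antipode k (x k) = -(g k * x k) := antipodeMap_x k

theorem act_g (φ : Sweedler k →ₗ[k] Sweedler k) (h : Sweedler k) :
    act k (Sweedler k) (g k) φ h = g k * φ (g k * h * g k) := by
  change (WithConv.toConv (opA k (Sweedler k)) * (WithConv.toConv (opB k (Sweedler k)) * WithConv.toConv (opC k (Sweedler k))))
    (g k) φ h = _
  simp [LinearMap.convMul_apply, comul_eq, antipode_g, mul_assoc]

/-- The three terms come from the iterated coproduct x ⊗ 1 ⊗ 1 + g ⊗ x ⊗ 1 + g ⊗ g ⊗ x, and the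
minus sign from S(x) = -gx. -/
theorem act_x (φ : Sweedler k →ₗ[k] Sweedler k) (h : Sweedler k) :
    act k (Sweedler k) (x k) φ h =
      φ (h * x k) + x k * φ (h * g k) - g k * φ (g k * x k * h * g k) := by
  change (WithConv.toConv (opA k (Sweedler k)) * (WithConv.toConv (opB k (Sweedler k)) * WithConv.toConv (opC k (Sweedler k))))
    (x k) φ h = _
  simp [LinearMap.convMul_apply, comul_eq, antipode_x, mul_assoc,
    Algebra.TensorProduct.one_def]
  abel

/-- The action is multiplicative, so gx acts as g after x and the formulas for the two generators
suffice. -/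
theorem act_eq (a : Sweedler k) (φ : Sweedler k →ₗ[k] Sweedler k) (h : Sweedler k) :
    act k (Sweedler k) a φ h = a.re • φ h + a.imI • act k _ (g k) φ h + a.imJ • act k _ (x k) φ h +
      a.imK • (g k * act k _ (x k) φ (g k * h * g k)) := by
  conv_lhs => rw [eq_lincomb k a]
  simp only [map_add, map_smul, act_one, act_mul, LinearMap.add_apply, LinearMap.smul_apply,
    Module.End.one_apply, Module.End.mul_apply, act_g]

theorem star_one (f φ : Sweedler k →ₗ[k] Sweedler k) : star f φ 1 = act k _ (f 1) φ 1 := by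
  simp [star, Algebra.TensorProduct.one_def]

theorem star_g (f φ : Sweedler k →ₗ[k] Sweedler k) :
    star f φ (g k) = act k _ (f (g k)) φ (g k) := by
  simp [star, comul_eq]

theorem star_x (f φ : Sweedler k →ₗ[k] Sweedler k) :
    star f φ (x k) = act k _ (f (x k)) φ 1 + act k _ (f (g k)) φ (x k) := by
  simp [star, comul_eq]

/-- Here g² = 1 gives Δ(gx) = gx ⊗ g + 1 ⊗ gx. -/
theorem star_gx (f φ : Sweedler k →ₗ[k] Sweedler k) : star f φ (g k * x k) =
    act k _ (f (g k * x k)) φ (g k) + act k _ (f 1) φ (g k * x k) := by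
  simp [star, comul_eq, mul_add, g_mul_g]

theorem act_x_one (φ : Sweedler k →ₗ[k] Sweedler k) : act k _ (x k) φ 1 =
    φ (x k) + x k * φ (g k) + g k * φ (x k) := by
  rw [act_x, mul_one, g_mul_x_mul_g, map_neg, mul_neg, sub_neg_eq_add, one_mul, one_mul]

theorem act_x_g (φ : Sweedler k →ₗ[k] Sweedler k) : act k _ (x k) φ (g k) =
    φ (g k * x k) + x k * φ 1 - g k * φ (g k * x k) := by
  rw [act_x, g_mul_g, mul_assoc _ (g k) (g k), g_mul_g, mul_one]

theorem act_x_x (φ : Sweedler k →ₗ[k] Sweedler k) : act k _ (x k) φ (x k) =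
    -(x k * φ (g k * x k)) := by
  rw [act_x, mul_assoc (g k), x_mul_x, g_mul_x]
  simp

theorem act_x_gx (φ : Sweedler k →ₗ[k] Sweedler k) : act k _ (x k) φ (g k * x k) =
    -(x k * φ (x k)) := by
  have h : g k * x k * (g k * x k) = 0 := by
    rw [← mul_assoc, g_mul_x_mul_g, neg_mul, x_mul_x, neg_zero]
  rw [act_x, h, g_mul_x_mul_g, mul_assoc, x_mul_x]
  simp

theorem conj_gx : g k * (g k * x k) * g k = -(g k * x k) := by
  rw [mul_assoc, g_mul_x_mul_g, mul_neg]

theorem act_apply_one (a : Sweedler k) (φ : Sweedler k →ₗ[k] Sweedler k) :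
    act k _ a φ 1 = a.re • φ 1 + a.imI • (g k * φ 1) +
      a.imJ • (φ (x k) + x k * φ (g k) + g k * φ (x k)) +
      a.imK • (g k * (φ (x k) + x k * φ (g k) + g k * φ (x k))) := by
  rw [act_eq, act_g, mul_one, g_mul_g, act_x_one]

theorem act_apply_g (a : Sweedler k) (φ : Sweedler k →ₗ[k] Sweedler k) :
    act k _ a φ (g k) = a.re • φ (g k) + a.imI • (g k * φ (g k)) +
      a.imJ • (φ (g k * x k) + x k * φ 1 - g k * φ (g k * x k)) +
      a.imK • (g k * (φ (g k * x k) + x k * φ 1 - g k * φ (g k * x k))) := by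
  rw [act_eq, act_g, g_mul_g, one_mul, act_x_g]

theorem act_apply_x (a : Sweedler k) (φ : Sweedler k →ₗ[k] Sweedler k) :
    act k _ a φ (x k) = a.re • φ (x k) - a.imI • (g k * φ (x k)) -
      a.imJ • (x k * φ (g k * x k)) + a.imK • (g k * (x k * φ (g k * x k))) := by
  rw [act_eq, act_g, g_mul_x_mul_g, act_x_x, map_neg, map_neg, act_x_x, neg_neg]
  simp only [mul_neg, smul_neg, sub_eq_add_neg]

theorem act_apply_gx (a : Sweedler k) (φ : Sweedler k →ₗ[k] Sweedler k) :
    act k _ a φ (g k * x k) = a.re • φ (g k * x k) - a.imI • (g k * φ (g k * x k)) -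
      a.imJ • (x k * φ (x k)) + a.imK • (g k * (x k * φ (x k))) := by
  rw [act_eq, act_g, conj_gx, act_x_gx, map_neg, map_neg, act_x_gx, neg_neg]
  simp only [mul_neg, smul_neg, sub_eq_add_neg]

end TwistedDouble

/-! ### The two-dimensional representation and its matrix units. -/

namespace TwistedDouble

open Sweedler

variable {k : Type u} [Field k]

/-- The linear endomorphism of Sweedler's algebra with given values on the basis
`1, g, x, gx`. -/
def endo (a b c d : Sweedler k) : Sweedler k →ₗ[k] Sweedler k where
  toFun h := h.re • a + h.imI • b + h.imJ • c + h.imK • d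
  map_add' h l := by
    simp only [QuaternionAlgebra.re_add, QuaternionAlgebra.imI_add, QuaternionAlgebra.imJ_add,
      QuaternionAlgebra.imK_add]
    module
  map_smul' t h := by
    simp only [QuaternionAlgebra.re_smul, QuaternionAlgebra.imI_smul, QuaternionAlgebra.imJ_smul,
      QuaternionAlgebra.imK_smul, smul_eq_mul, RingHom.id_apply]
    module

section

variable (a b c d : Sweedler k)

@[simp] theorem endo_one : endo a b c d 1 = a := by simp [endo]

@[simp] theorem endo_g : endo a b c d (g k) = b := by simp [endo, g]

@[simp] theorem endo_x : endo a b c d (x k) = c := by simp [endo, x]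

@[simp] theorem endo_gx : endo a b c d (g k * x k) = d := by simp [endo, g, x]

end

variable (k) in
/-- The matrix units of the block of the twisted double of Sweedler's algebra on which `gg'` and
`σ` act by `1`. -/
def matrixUnit : Fin 2 → Fin 2 → Sweedler k →ₗ[k] Sweedler k :=
  ![![endo ⟨1 / 2, 1 / 2, 0, 0⟩ 0 0 ⟨0, 0, -1 / 4, 1 / 4⟩, endo ⟨0, 0, 1 / 2, 1 / 2⟩ 0 0 0],
    ![endo 0 0 ⟨1 / 4, 1 / 4, 0, 0⟩ 0, endo 0 0 ⟨0, 0, 1 / 4, 1 / 4⟩ 0]]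

variable (k) in
/-- The two-dimensional representation of the twisted double of Sweedler's algebra on which `gg'`
and `σ` act by `1`. -/
def rhoLin : (Sweedler k →ₗ[k] Sweedler k) →ₗ[k] Matrix (Fin 2) (Fin 2) k where
  toFun f := !![(f 1).re + (f 1).imI, (f 1).imJ + (f 1).imK;
    2 * ((f (x k)).re + (f (x k)).imI),
    (f (g k)).re - (f (g k)).imI + 2 * ((f (x k)).imJ + (f (x k)).imK)]
  map_add' f h := by
    ext i j
    fin_cases i <;> fin_cases j <;> simp <;> ring
  map_smul' t f := by
    ext i j
    fin_cases i <;> fin_cases j <;> simp <;> ring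

theorem rhoLin_apply (f : Sweedler k →ₗ[k] Sweedler k) : rhoLin k f =
    !![(f 1).re + (f 1).imI, (f 1).imJ + (f 1).imK;
      2 * ((f (x k)).re + (f (x k)).imI),
      (f (g k)).re - (f (g k)).imI + 2 * ((f (x k)).imJ + (f (x k)).imK)] := rfl

theorem rhoLin_unit : rhoLin k (unit : Sweedler k →ₗ[k] Sweedler k) = 1 := by
  rw [rhoLin_apply]
  ext i j
  fin_cases i <;> fin_cases j <;> simp [unit_apply, counit_eq]

theorem g_mul_eq (a : Sweedler k) : g k * a = ⟨a.imI, a.re, a.imK, a.imJ⟩ := by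
  ext <;> simp [g]

theorem x_mul_eq (a : Sweedler k) : x k * a = ⟨0, 0, a.re, -a.imI⟩ := by
  ext <;> simp [x]

/-- The value φ(gx), absent from `rhoLin`, enters the lower right entry of the left side twice,
through the values of the product at g and at x; the weight 2 on the second makes the contributions
cancel. -/
theorem rhoLin_star (f φ : Sweedler k →ₗ[k] Sweedler k) :
    rhoLin k (star f φ) = rhoLin k f * rhoLin k φ := by
  simp only [rhoLin_apply, star_one, star_g, star_x, act_apply_one, act_apply_g, act_apply_x]
  generalize f 1 = f1
  generalize f (g k) = fg
  generalize f (x k) = fx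
  ext i j
  fin_cases i <;> fin_cases j <;> simp [Matrix.mul_apply, g_mul_eq, x_mul_eq] <;> ring

theorem matrixUnit_zero_zero : matrixUnit k 0 0 =
    endo ⟨1 / 2, 1 / 2, 0, 0⟩ 0 0 ⟨0, 0, -1 / 4, 1 / 4⟩ := rfl

theorem matrixUnit_zero_one : matrixUnit k 0 1 = endo ⟨0, 0, 1 / 2, 1 / 2⟩ 0 0 0 := rfl

theorem matrixUnit_one_zero : matrixUnit k 1 0 = endo 0 0 ⟨1 / 4, 1 / 4, 0, 0⟩ 0 := rfl

theorem matrixUnit_one_one : matrixUnit k 1 1 = endo 0 0 ⟨0, 0, 1 / 4, 1 / 4⟩ 0 := rfl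

variable [CharZero k]

theorem rhoLin_matrixUnit (i j : Fin 2) : rhoLin k (matrixUnit k i j) = Matrix.single i j 1 := by
  rw [rhoLin_apply]
  ext l m
  fin_cases i <;> fin_cases j <;> fin_cases l <;> fin_cases m <;>
    simp [matrixUnit] <;> ring

/-- The span of the matrix units with fixed second index is a left ideal, and `rhoLin` is the matrix
of left multiplication on it. An equality of endomorphisms is tested on the basis 1, g, x, gx. -/
theorem star_matrixUnit (f : Sweedler k →ₗ[k] Sweedler k) (i j : Fin 2) :
    star f (matrixUnit k i j) = ∑ l, rhoLin k f l i • matrixUnit k l j := by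
  revert i j
  simp only [Fin.forall_fin_two, Fin.sum_univ_two, rhoLin_apply, Matrix.of_apply, Matrix.cons_val',
    Matrix.cons_val_zero, Matrix.cons_val_one, Matrix.cons_val_fin_one, matrixUnit_zero_zero,
    matrixUnit_zero_one, matrixUnit_one_zero, matrixUnit_one_one]
  refine ⟨⟨?_, ?_⟩, ?_, ?_⟩ <;> refine linearMap_ext k ?_ ?_ ?_ ?_ <;>
  simp only [star_one, star_g, star_x, star_gx, act_apply_one, act_apply_g, act_apply_x,
    act_apply_gx, LinearMap.add_apply, LinearMap.smul_apply, endo_one, endo_g, endo_x, endo_gx,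
    smul_zero, mul_zero, add_zero, zero_add, sub_zero] <;>
  -- The value f(gx) must drop out, as `rhoLin` does not see it. It does because every matrix unit φ
  -- satisfies φ(g) = 0 and φ(gx) + xφ(1) - gφ(gx) = 0; this explains the value of `matrixUnit k 0
  -- 0` at gx.
  generalize f (g k * x k) = fgx <;>
  ext <;> simp [g_mul_eq, x_mul_eq] <;> ring

/-- Together with `star_matrixUnit`, this makes the span of the matrix units a two-sided ideal, so
that the matrix algebra is a direct factor and not only a quotient. -/
theorem matrixUnit_star (f : Sweedler k →ₗ[k] Sweedler k) (i j : Fin 2) :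
    star (matrixUnit k i j) f = ∑ l, rhoLin k f j l • matrixUnit k i l := by
  revert i j
  simp only [Fin.forall_fin_two, Fin.sum_univ_two, rhoLin_apply, Matrix.of_apply, Matrix.cons_val',
    Matrix.cons_val_zero, Matrix.cons_val_one, Matrix.cons_val_fin_one, matrixUnit_zero_zero,
    matrixUnit_zero_one, matrixUnit_one_zero, matrixUnit_one_one]
  refine ⟨⟨?_, ?_⟩, ?_, ?_⟩ <;> refine linearMap_ext k ?_ ?_ ?_ ?_ <;>
  simp only [star_one, star_g, star_x, star_gx, act_apply_one, act_apply_g, act_apply_x,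
    act_apply_gx, LinearMap.add_apply, LinearMap.smul_apply, endo_one, endo_g, endo_x, endo_gx,
    smul_zero, add_zero] <;>
  generalize f (g k * x k) = fgx <;>
  ext <;> simp [g_mul_eq, x_mul_eq] <;> ring

end TwistedDouble

/-! ### The matrix factor of the block D_0. -/

namespace TwistedDouble

open Sweedler

variable {k : Type u} [Field k]

theorem one_eq_endo : (1 : TwistedDouble k (Sweedler k)) = of k _ (endo 1 1 0 0) := by
  refine linearMap_ext k ?_ ?_ ?_ ?_
  all_goals
    change (unit : Sweedler k →ₗ[k] Sweedler k) _ = endo 1 1 0 0 _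
    simp [unit_apply, counit_eq]

theorem sigma_eq_endo : sigma k (Sweedler k) = of k _ (endo 1 (g k) (x k) (g k * x k)) := by
  refine linearMap_ext k ?_ ?_ ?_ ?_
  all_goals
    change LinearMap.id (R := k) _ = endo 1 (g k) (x k) (g k * x k) _
    simp

theorem chi_g : chi k (g k) = -1 := by
  simp [chi, g, QuaternionAlgebra.Basis.liftHom, QuaternionAlgebra.Basis.lift]

theorem chi_x : chi k (x k) = 0 := by
  simp [chi, x, QuaternionAlgebra.Basis.liftHom, QuaternionAlgebra.Basis.lift]

theorem gEl_mul_gDual : gEl k * gDual k = of k (Sweedler k) (endo (g k) (-g k) 0 0) := by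
  refine linearMap_ext k ?_ ?_ ?_ ?_
  all_goals
    change star ((Coalgebra.counit : Sweedler k →ₗ[k] k).smulRight (g k))
      ((chi k).toLinearMap.smulRight (1 : Sweedler k)) _ = endo (g k) (-g k) 0 0 _
    simp only [star_one, star_g, star_x, star_gx, act_apply_one, act_apply_g, act_apply_x,
      act_apply_gx, endo_one, endo_g, endo_x, endo_gx]
    simp only [LinearMap.smulRight_apply, AlgHom.toLinearMap_apply, counit_eq, map_mul, map_one,
      chi_g, chi_x, counitHom_g, counitHom_x]
    ext <;> simp [g]

/-- The only product needed to expand (gg' - 1)(1 + σ), the element whose vanishing in D_0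
identifies ∑ `E i i` with (1 + σ)/2. -/
theorem gEl_mul_gDual_mul_sigma : gEl k * gDual k * sigma k (Sweedler k) =
    of k (Sweedler k) (endo (g k) (-1) (g k * x k) (-x k)) := by
  rw [gEl_mul_gDual, sigma_eq_endo]
  refine linearMap_ext k ?_ ?_ ?_ ?_
  all_goals
    change star (endo (g k) (-g k) 0 0) (endo 1 (g k) (x k) (g k * x k)) _ =
      endo (g k) (-1) (g k * x k) (-x k) _
    simp only [star_one, star_g, star_x, star_gx, act_apply_one, act_apply_g, act_apply_x,
      act_apply_gx, endo_one, endo_g, endo_x, endo_gx]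
    ext <;> simp [g, x]

/-- The complement of the block is annihilated by `gg' - 1` or `σ + 1`. -/
theorem one_sub_matrixUnit [CharZero k] :
    (1 : TwistedDouble k (Sweedler k)) - ∑ i, of k _ (matrixUnit k i i) -
        (-1 / 2 : k) • (sigma k (Sweedler k) - 1) =
      (gEl k * gDual k - 1) * ((-1 / 4 : k) • (1 + sigma k (Sweedler k))) := by
  rw [mul_smul_comm, mul_add, mul_one, sub_mul, one_mul, gEl_mul_gDual_mul_sigma, gEl_mul_gDual,
    Fin.sum_univ_two, one_eq_endo, sigma_eq_endo, matrixUnit_zero_zero, matrixUnit_one_one]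
  have h : endo 1 1 0 0 - (endo ⟨1 / 2, 1 / 2, 0, 0⟩ 0 0 ⟨0, 0, -1 / 4, 1 / 4⟩ +
        endo 0 0 ⟨0, 0, 1 / 4, 1 / 4⟩ 0) - (-1 / 2 : k) • (endo 1 (g k) (x k) (g k * x k) -
          endo 1 1 0 0) =
      (-1 / 4 : k) • (endo (g k) (-g k) 0 0 - endo 1 1 0 0 +
        (endo (g k) (-1) (g k * x k) (-x k) - endo 1 (g k) (x k) (g k * x k))) := by
    refine linearMap_ext k ?_ ?_ ?_ ?_
    all_goals
      simp only [LinearMap.add_apply, LinearMap.sub_apply, LinearMap.smul_apply, endo_one, endo_g,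
        endo_x, endo_gx]
      ext <;> simp [g, x] <;> ring
  exact h

/-- The representation of the twisted double given by `rhoLin`. -/
def rhoHom (k : Type u) [Field k] : TwistedDouble k (Sweedler k) →ₐ[k] Matrix (Fin 2) (Fin 2) k :=
  AlgHom.ofLinearMap (rhoLin k) rhoLin_unit rhoLin_star

theorem rhoHom_of (f : Sweedler k →ₗ[k] Sweedler k) : rhoHom k (of k _ f) = rhoLin k f := rfl

theorem rhoHom_gEl_mul_gDual_sub_one : rhoHom k (gEl k * gDual k - (-1) ^ 0) = 0 := by
  rw [pow_zero, map_sub, map_one, gEl_mul_gDual, rhoHom_of, rhoLin_apply]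
  simp only [endo_one, endo_g, endo_x]
  ext i j
  fin_cases i <;> fin_cases j <;> simp [g]

theorem rhoHom_sigma_sub_one : rhoHom k (sigma k (Sweedler k) - 1) = 0 := by
  rw [map_sub, map_one, sigma_eq_endo, rhoHom_of, rhoLin_apply]
  simp only [endo_one, endo_g, endo_x]
  ext i j
  fin_cases i <;> fin_cases j <;> simp [g, x]
  -- In the lower right entry σ contributes -1 from its value at g and 2 from its value at x,
  -- together 1.
  ring

/-- The matrix block of `D_0` on which `σ` acts by `1`. -/
def matrixBlock (k : Type u) [Field k] [CharZero k] :
    MatrixBlock k (DBlock k 0) (sigmaSubOne k 0) (Fin 2) where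
  rho := quotientByLift (rhoHom k) rhoHom_gEl_mul_gDual_sub_one
  E i j := (of k _ (matrixUnit k i j) : DBlock k 0)
  rho_E i j := rhoLin_matrixUnit i j
  mul_E r i j := by
    induction r using Quotient.inductionOn with
    | _ r =>
      have h : r * of k _ (matrixUnit k i j) = ∑ l, rhoHom k r l i • of k _ (matrixUnit k l j) :=
        star_matrixUnit r i j
      rw [Fin.sum_univ_two] at h ⊢
      exact congrArg (fun t : TwistedDouble k (Sweedler k) => (t : DBlock k 0)) h
  E_mul r i j := by
    induction r using Quotient.inductionOn with
    | _ r =>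
      have h : of k _ (matrixUnit k i j) * r = ∑ l, rhoHom k r j l • of k _ (matrixUnit k i l) :=
        matrixUnit_star r i j
      rw [Fin.sum_univ_two] at h ⊢
      exact congrArg (fun t : TwistedDouble k (Sweedler k) => (t : DBlock k 0)) h
  rho_z := rhoHom_sigma_sub_one
  -- The inverse of σ - 1 = -2 on the complementary factor, where σ = -1.
  c := -1 / 2
  one_sub_sum_E := by
    refine sub_eq_zero.1 ?_
    have h := one_sub_matrixUnit (k := k)
    rw [Fin.sum_univ_two] at h ⊢
    refine (congrArg (fun t : TwistedDouble k (Sweedler k) => (t : DBlock k 0)) h).trans ?_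
    -- The defect in the twisted double is a right multiple of gg' - 1, hence zero in D_0.
    refine quotientBy_mk_eq_zero.2 (TwoSidedIdeal.mul_mem_right _ _ _ ?_)
    rw [pow_zero]
    exact TwoSidedIdeal.subset_span rfl

end TwistedDouble

end

theorem lemma3p4 (k : Type u) [Field k] [IsAlgClosed k] [CharZero k] :
    (∃ F : DGFunctor (CBlock.{u, w} k 0) (mixedComplexes.{u, w} k),
      F.IsQuasiEquivalence ∧
      (∀ (M N : DGModule.{u, u, w} (DBlockTheta k 0)) (f : (CBlock.{u, w} k 0).Hom M N 0),
        (CBlock.{u, w} k 0).Closed f → (DGModule.QuasiIso f ↔ DGModule.QuasiIso (F.map f))) ∧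
      ∃ h : ∀ M : DGModule.{u, u, w} (DBlockTheta k 0),
          DGModule.HProjective M → DGModule.HProjective (F.obj M),
        (F.restrict DGModule.HProjective DGModule.HProjective h).IsQuasiEquivalence) ∧
    (∃ E : CategoryTheory.Equivalence (ModuleCat.{w} (quotientBy (sigmaSubOne k 0)))
        (ModuleCat.{w} k), CategoryTheory.Functor.Linear k E.functor) ∧
    ⨆ μ : k, Module.End.eigenspace (LinearMap.mulLeft k (sigmaSubOne k 0)) μ = ⊤ :=
  -- The corner is taken at the index 0 of `Fin 2`; the general results allow any primitive diagonal
  -- idempotent.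
  ⟨⟨(TwistedDouble.matrixBlock k).cornerFunctor (sigmaSubOne_comm k 0) 0,
      (TwistedDouble.matrixBlock k).cornerFunctor_isQuasiEquivalence 0,
      fun _ _ f hf => (TwistedDouble.matrixBlock k).quasiIso_iff_cornerHom 0 f hf,
      fun _ hM => (TwistedDouble.matrixBlock k).hProjective_corner 0 hM,
      (TwistedDouble.matrixBlock k).cornerFunctor_restrict_isQuasiEquivalence 0⟩,
    ⟨(TwistedDouble.matrixBlock k).moduleCatEquiv 0, (TwistedDouble.matrixBlock k).moduleCatEquiv_functor_linear 0⟩,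
    (TwistedDouble.matrixBlock k).iSup_eigenspace_mulLeft⟩
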